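/- Let $k$ be an arbitrary field and let $Q$ be a Dynkin quiver with vertex set $I$, i.e. an orientation of a Dynkin diagram of type $A_n$ ($n\ge 1$), $D_n$ ($n\ge 4$), $E_6$, $E_7$ or $E_8$. Let $\mathfrak g$ be the finite-dimensional simple complex Lie algebra associated to the underlying Dynkin diagram, with a Cartan subalgebra $\mathfrak h$ and simple roots $\alpha_i$ ($i\in I$) whose Cartan matrix is that of the diagram, and let $\omega_i\in\mathfrak h^*$ be the fundamental weights, so that $\omega_i(\alpha_j^\vee)=\delta_{ij}$ for all $j \in I$. Write $\langle\alpha,\omega\rangle=\omega(\alpha^\vee)$ for a root $\alpha$, with coroot $\alpha^\vee$, and $\omega\in\mathfrak h^*$. The weight $\omega_i$ is called minuscule if $-\langle\alpha,\omega_i\rangle\le 1$ for all negative roots $\alpha$. For $i\in I$ let $S(i)$ be the simple representation of $Q$ over $k$ that is one-dimensional at $i$ and zero at all other vertices. The quiver $Q$ is called special (over $k$) if $\dim_k\operatorname{Hom}(X,S(i))\le 1$ for all $i\in I$ and all indecomposable finite-dimensional representations $X$ of $Q$ over $k$. A source of $Q$ is a vertex at which no arrow ends. Then $Q$ is special if and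 only if for each vertex $i\in I$ that is a source of $Q$ the fundamental weight $\omega_i$ is minuscule. Moreover, no quiver of type $E_8$ is special. -/

import Mathlib

universe u v w z

/-! ### Quivers of Dynkin type -/

namespace DynkinQuiver

/-- The (symmetric, generalized) Cartan matrix of a quiver with finitely many arrows between any
two vertices: `2 δ_{ij}` minus the number of arrows between `i` and `j`, in either direction. Off
the diagonal this is the negative of the adjacency matrix of the underlying undirected multigraph,
and a diagonal entry is `2` if and only if there is no loop at the vertex. -/
noncomputable def cartanMatrix (I : Type v) [Quiver.{w} I] : Matrix I I ℤ :=
  open Classical in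
  Matrix.of fun i j => (if i = j then 2 else 0) - (Nat.card (i ⟶ j) : ℤ) - (Nat.card (j ⟶ i) : ℤ)

/-- The underlying undirected graph of the quiver `I` is the (simply-laced) Dynkin diagram with
Cartan matrix `C`, up to a labelling of the vertices. -/
def HasType (I : Type v) [Quiver.{w} I] {n : ℕ} (C : Matrix (Fin n) (Fin n) ℤ) : Prop :=
  (∀ i j : I, Finite (i ⟶ j)) ∧ ∃ e : I ≃ Fin n, ∀ i j : I, cartanMatrix I i j = C (e i) (e j)

/-- A Dynkin quiver: an orientation of a Dynkin diagram of type `Aₙ` (`n ≥ 1`), `Dₙ` (`n ≥ 4`),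
`E₆`, `E₇` or `E₈`. -/
def IsDynkin (I : Type v) [Quiver.{w} I] : Prop :=
  (∃ n, 1 ≤ n ∧ HasType I (CartanMatrix.A n)) ∨ (∃ n, 4 ≤ n ∧ HasType I (CartanMatrix.D n)) ∨
    HasType I CartanMatrix.E₆ ∨ HasType I CartanMatrix.E₇ ∨ HasType I CartanMatrix.E₈

/-- A source: a vertex at which no arrow ends. -/
def IsSource {I : Type v} [Quiver.{w} I] (i : I) : Prop :=
  ∀ j : I, IsEmpty (j ⟶ i)

/-! ### Representations, that is, modules over the path algebra -/

/-- A representation over `k` of the quiver `I`: a vector space at every vertex and a linear map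
for every arrow. -/
structure Rep (k : Type u) [Field k] (I : Type v) [Quiver.{w} I] where
  /-- the vector space at a vertex -/
  V : I → Type u
  [addCommGroup : ∀ i, AddCommGroup (V i)]
  [module : ∀ i, Module k (V i)]
  /-- the linear map along an arrow -/
  map : ∀ {i j : I}, (i ⟶ j) → V i →ₗ[k] V j

attribute [instance] Rep.addCommGroup Rep.module

namespace Rep

variable {k : Type u} [Field k] {I : Type v} [Quiver.{w} I]

/-- Finite-dimensionality (for quivers with finitely many vertices). -/
def IsFiniteDimensional (X : Rep k I) : Prop :=
  ∀ i, FiniteDimensional k (X.V i)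

/-- The `k`-vector space `Hom(X, Y)` of morphisms of representations: families of linear maps that
commute with the maps along all arrows. -/
def Hom (X Y : Rep k I) : Submodule k (∀ i, X.V i →ₗ[k] Y.V i) where
  carrier := {f | ∀ (i j : I) (a : i ⟶ j), f j ∘ₗ X.map a = Y.map a ∘ₗ f i}
  add_mem' := by
    intro f g hf hg i j a
    simp only [Pi.add_apply, LinearMap.add_comp, LinearMap.comp_add, hf i j a, hg i j a]
  zero_mem' := by
    intro i j a
    simp only [Pi.zero_apply, LinearMap.zero_comp, LinearMap.comp_zero]
  smul_mem' := by
    intro c f hf i j a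
    simp only [Pi.smul_apply, LinearMap.smul_comp, LinearMap.comp_smul, hf i j a]

/-- A family of subspaces is a subrepresentation if it is stable under the maps along all
arrows. -/
def IsSubrep (X : Rep k I) (U : ∀ i, Submodule k (X.V i)) : Prop :=
  ∀ (i j : I) (a : i ⟶ j), ∀ x ∈ U i, X.map a x ∈ U j

/-- A representation is indecomposable if it is nonzero and is not the direct sum of two nonzero
subrepresentations. -/
def IsIndecomposable (X : Rep k I) : Prop :=
  (∃ i, Nontrivial (X.V i)) ∧
    ∀ U W : ∀ i, Submodule k (X.V i), X.IsSubrep U → X.IsSubrep W →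
      (∀ i, IsCompl (U i) (W i)) → (∀ i, U i = ⊥) ∨ (∀ i, W i = ⊥)

/-- The simple representation `S(i)`: one-dimensional at the vertex `i` (where the space is the
line `⊤ ⊆ k`) and zero at all other vertices (where it is `⊥ ⊆ k`); all maps are zero. -/
noncomputable def simple (k : Type u) [Field k] {I : Type v} [Quiver.{w} I] (i : I) : Rep k I :=
  open Classical in
  { V := fun j => ↥(if j = i then (⊤ : Submodule k k) else ⊥)
    map := fun _ => 0 }

end Rep

/-- The quiver `I` is special over `k`: `dim Hom(X, S(i)) ≤ 1` for all vertices `i` and all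
(finite-dimensional) indecomposable representations `X`. -/
def IsSpecial (k : Type u) [Field k] (I : Type v) [Quiver.{w} I] : Prop :=
  ∀ (i : I) (X : Rep k I), X.IsFiniteDimensional → X.IsIndecomposable →
    Module.finrank k (Rep.Hom X (Rep.simple k i)) ≤ 1

/-! ### The associated Lie algebra and its fundamental weights -/

section LieAlgebra

variable {𝔤 : Type z} [LieRing 𝔤] [LieAlgebra ℂ 𝔤] [FiniteDimensional ℂ 𝔤]
  [LieAlgebra.IsKilling ℂ 𝔤] {H : LieSubalgebra ℂ 𝔤} [H.IsCartanSubalgebra]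

/-- The semisimple complex Lie algebra `𝔤`, with Cartan subalgebra `H` and base `b` of its root
system, is the one associated to the underlying diagram of the quiver `I`, the simple root `α_i`
being `e i`: the Cartan matrix of `𝔤` is the one of the diagram. -/
def IsAssociated (I : Type v) [Quiver.{w} I] (b : (LieAlgebra.IsKilling.rootSystem H).Base)
    (e : I ≃ b.support) : Prop :=
  ∀ i j : I, b.cartanMatrix (e i) (e j) = cartanMatrix I i j

/-- The fundamental weight `ω_s` of the simple root `s`: the linear form on `H` that is `1` on the
simple coroot of `s` and `0` on the other simple coroots. -/
noncomputable def fundamentalWeight (b : (LieAlgebra.IsKilling.rootSystem H).Base)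
    (s : b.support) : Module.Dual ℂ H :=
  b.toCoweightBasis.coord s

/-- The root `α` is negative with respect to the base `b`. -/
def IsNegative (b : (LieAlgebra.IsKilling.rootSystem H).Base) (α : H.root) : Prop :=
  -(LieAlgebra.IsKilling.rootSystem H).root α ∈
    AddSubmonoid.closure ((LieAlgebra.IsKilling.rootSystem H).root '' b.support)

/-- The weight `ω` is minuscule: `-⟨α, ω⟩ ≤ 1` for all negative roots `α`, where
`⟨α, ω⟩ = ω(α^∨)`. (As an element of `ℂ`, this number is to be an integer which is at most `1`.) -/
def IsMinuscule (b : (LieAlgebra.IsKilling.rootSystem H).Base) (ω : Module.Dual ℂ H) : Prop :=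
  ∀ α : H.root, IsNegative b α →
    ∃ m : ℤ, -ω ((LieAlgebra.IsKilling.rootSystem H).coroot α) = m ∧ m ≤ 1

end LieAlgebra

end DynkinQuiver

/-!
The proof has two halves, which meet in a statement about the Tits form `a ↦ ⟨a, a⟩` of the quiver:
*`Q` is special if and only if `aᵢ ≤ 1` for all sources `i` and all `a ≥ 0` with `⟨a, a⟩ = 1`*
(`isSpecial_iff`). All that is used of the Dynkin condition is that the Tits form is positive
definite and that there are finitely many arrows.

**Representations.** `Hom(X, Y)` and `Ext¹(X, Y)` are the kernel and the cokernel of one linear map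
(`coboundary`), whence `dim Hom(X, Y) - dim Ext¹(X, Y) = ⟨dim X, dim Y⟩`. From this one gets what is
needed of Gabriel's theorem, over any field and without reflection functors.
* An indecomposable `X` is a brick, by Ringel's lemma (`IsIndecomposable.isBrick`) and induction on
  the dimension. Its endomorphisms form a division algebra `D`, which acts on `Ext¹(X, X)` and on
  all the spaces `Xᵢ`. Positive definiteness forces `Ext¹(X, X) = 0`, and then
  `⟨dim X, dim X⟩ = dim D` is divisible by `(dim D)²`, so that `⟨dim X, dim X⟩ = 1`.
* Conversely, for `a ≥ 0` with `⟨a, a⟩ = 1` consider a representation `X` of dimension vector `a`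
  with `dim End(X)` as small as possible. If it were not rigid, it would split as `A ⊕ B` with
  `Ext¹(B, A) ≠ 0`, and a nonsplit extension would have fewer endomorphisms. So `X` is rigid,
  `dim End(X) = ⟨a, a⟩ = 1` and `X` is indecomposable (`exists_isIndecomposable_dimVec_eq`).
* If `X` is rigid and `Hom(X, S(i)) ≠ 0`, then `Ext¹(X, S(i)) = 0` by right exactness, and
  `dim Hom(X, S(i)) = ⟨dim X, eᵢ⟩`.

Hence `Q` is special if and only if `⟨a, eᵢ⟩ ≤ 1` for all `i` and all `a ≥ 0` with `⟨a, a⟩ = 1`.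
At a source `⟨a, eᵢ⟩ = aᵢ`. A violation at `i` moves backwards along any arrow `j ⟶ i`, as the
reflection `sⱼ(a)` violates the condition at `j` (`exists_two_le_eulerForm_of_hom`); there being no
oriented cycles, it arrives at a source.

**Root systems.** If the Cartan matrix of the diagram is the one of a Lie algebra, the Tits form is
positive definite, and the solutions of `⟨a, a⟩ = 1` are exactly the coefficient vectors of the
coroots (`exists_hasCoeffs`, `exists_root_hasCoeffs`), the pairing of a coroot with `ωᵢ` being `aᵢ`.
For `E₈`, positive definiteness is a completion of squares, and all coefficients of the highest root
are at least `2`, in particular those at the sources, of which there is at least one.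
-/

/-! ### The Euler form and its roots -/

namespace DynkinQuiver

section EulerForm

lemma cartanMatrix_symm {I : Type v} [Quiver.{w} I] (i j : I) :
    cartanMatrix I i j = cartanMatrix I j i := by
  rcases eq_or_ne i j with rfl | h
  · rfl
  · simp only [cartanMatrix, Matrix.of_apply, if_neg h, if_neg h.symm]
    ring

variable {I : Type v} [Quiver.{w} I] [Fintype I]

/-- The Euler form `⟨a, b⟩ = ∑ᵢ aᵢ bᵢ - ∑_{i ⟶ j} aᵢ bⱼ` of a finite quiver, on the lattice of
dimension vectors. -/
noncomputable def eulerForm : (I → ℤ) →ₗ[ℤ] (I → ℤ) →ₗ[ℤ] ℤ :=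
  LinearMap.mk₂ ℤ
    (fun a b => ∑ i, a i * b i - ∑ i, ∑ j, (Nat.card (i ⟶ j) : ℤ) * (a i * b j))
    (by
      intro a a' b
      simp only [Pi.add_apply, add_mul, mul_add, Finset.sum_add_distrib]
      ring)
    (by
      intro c a b
      simp only [Pi.smul_apply, smul_eq_mul, mul_sub, Finset.mul_sum]
      congr 1
      · exact Finset.sum_congr rfl fun i _ => by ring
      · exact Finset.sum_congr rfl fun i _ => Finset.sum_congr rfl fun j _ => by ring)
    (by
      intro a b b'
      simp only [Pi.add_apply, mul_add, Finset.sum_add_distrib]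
      ring)
    (by
      intro c a b
      simp only [Pi.smul_apply, smul_eq_mul, mul_sub, Finset.mul_sum]
      congr 1
      · exact Finset.sum_congr rfl fun i _ => by ring
      · exact Finset.sum_congr rfl fun i _ => Finset.sum_congr rfl fun j _ => by ring)

lemma eulerForm_apply (a b : I → ℤ) :
    eulerForm a b =
      ∑ i, a i * b i - ∑ i, ∑ j, (Nat.card (i ⟶ j) : ℤ) * (a i * b j) :=
  rfl

lemma eulerForm_single_right [DecidableEq I] (a : I → ℤ) (i : I) :
    eulerForm a (Pi.single i 1) = a i - ∑ j, (Nat.card (j ⟶ i) : ℤ) * a j := by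
  simp [eulerForm_apply, Pi.single_apply]

lemma eulerForm_single_left [DecidableEq I] (a : I → ℤ) (i : I) :
    eulerForm (Pi.single i 1) a = a i - ∑ j, (Nat.card (i ⟶ j) : ℤ) * a j := by
  simp [eulerForm_apply, Pi.single_apply]

lemma eulerForm_add_eulerForm_swap (a b : I → ℤ) :
    eulerForm a b + eulerForm b a = ∑ i, ∑ j, cartanMatrix I i j * (a i * b j) := by
  classical
  have h₁ : ∑ i, ∑ j, (Nat.card (i ⟶ j) : ℤ) * (b i * a j) =
      ∑ i, ∑ j, (Nat.card (j ⟶ i) : ℤ) * (a i * b j) := by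
    rw [Finset.sum_comm]
    exact Finset.sum_congr rfl fun i _ => Finset.sum_congr rfl fun j _ => by ring
  have h₂ : ∑ i, a i * b i = ∑ i, ∑ j, (if i = j then 1 else 0) * (a i * b j) := by
    simp
  have h₃ : ∑ i, b i * a i = ∑ i, a i * b i := Finset.sum_congr rfl fun i _ => mul_comm _ _
  rw [eulerForm_apply, eulerForm_apply, h₁, h₃, h₂]
  simp only [← Finset.sum_add_distrib, ← Finset.sum_sub_distrib]
  refine Finset.sum_congr rfl fun i _ => Finset.sum_congr rfl fun j _ => ?_
  simp only [cartanMatrix, Matrix.of_apply]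
  split_ifs <;> ring

variable (I) in
/-- The Tits form `a ↦ ⟨a, a⟩` is positive definite. In this case the solutions of `⟨a, a⟩ = 1` are
called roots in what follows. -/
def TitsPosDef : Prop :=
  ∀ a : I → ℤ, a ≠ 0 → 0 < eulerForm a a

namespace TitsPosDef

lemma card_loop_eq_zero (hpd : TitsPosDef I) (i : I) : Nat.card (i ⟶ i) = 0 := by
  classical
  have h := hpd (Pi.single i 1) (by simp)
  rw [eulerForm_single_right] at h
  simp [Pi.single_apply] at h
  omega

lemma eulerForm_single_self [DecidableEq I] (hpd : TitsPosDef I) (i : I) :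
    eulerForm (Pi.single i 1) (Pi.single i 1 : I → ℤ) = 1 := by
  rw [eulerForm_single_right]
  simp [Pi.single_apply, hpd.card_loop_eq_zero i]

/-- There are no oriented cycles. This is stated in the following form: a nonempty set of vertices
contains a vertex at which no arrow from the set ends. Otherwise its indicator function `a` would
satisfy `⟨a, a⟩ ≤ 0`. -/
lemma exists_forall_isEmpty_hom [∀ i j : I, Finite (i ⟶ j)] (hpd : TitsPosDef I) (B : Finset I)
    (hB : B.Nonempty) : ∃ i ∈ B, ∀ j ∈ B, IsEmpty (j ⟶ i) := by
  classical
  by_contra! hcon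
  let a : I → ℤ := fun i => if i ∈ B then 1 else 0
  obtain ⟨i₀, hi₀⟩ := hB
  have ha : a ≠ 0 := fun h => by simpa [a, hi₀] using congrFun h i₀
  have hlt := hpd a ha
  rw [eulerForm_apply, Finset.sum_comm, ← Finset.sum_sub_distrib] at hlt
  refine absurd hlt (not_lt.mpr (Finset.sum_nonpos fun i _ => ?_))
  by_cases hi : i ∈ B
  · obtain ⟨j, hj, ⟨x⟩⟩ := hcon i hi
    have hone : (1 : ℤ) ≤ Nat.card (j ⟶ i) := by
      have : Nonempty (j ⟶ i) := ⟨x⟩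
      exact_mod_cast Nat.one_le_iff_ne_zero.mpr Nat.card_pos.ne'
    have hle : (Nat.card (j ⟶ i) : ℤ) * (a j * a i) ≤
        ∑ l, (Nat.card (l ⟶ i) : ℤ) * (a l * a i) :=
      Finset.single_le_sum (f := fun l => (Nat.card (l ⟶ i) : ℤ) * (a l * a i))
        (fun l _ => by simp only [a]; split_ifs <;> simp) (Finset.mem_univ j)
    simp only [a, hi, hj, if_true, mul_one] at hle ⊢
    linarith
  · simp [a, hi]

/-- A root is positive or negative: writing `a = a⁺ - a⁻`, one has `⟨a⁺, a⁻⟩ ≤ 0` and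
`⟨a⁻, a⁺⟩ ≤ 0`, so that `⟨a, a⟩ ≥ ⟨a⁺, a⁺⟩ + ⟨a⁻, a⁻⟩`. -/
lemma nonneg_or_nonpos (hpd : TitsPosDef I) {a : I → ℤ} (haa : eulerForm a a = 1) :
    0 ≤ a ∨ a ≤ 0 := by
  have hcross (p n : I → ℤ) (hp : 0 ≤ p) (hn : 0 ≤ n) (hpn : ∀ i, p i * n i = 0) :
      eulerForm p n ≤ 0 := by
    rw [eulerForm_apply, Finset.sum_eq_zero fun i _ => hpn i, zero_sub, neg_nonpos]
    exact Finset.sum_nonneg fun i _ => Finset.sum_nonneg fun j _ =>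
      mul_nonneg (by positivity) (mul_nonneg (hp i) (hn j))
  have hdisj (i : I) : (a⁺) i * (a⁻) i = 0 := by
    rw [Pi.posPart_apply, Pi.negPart_apply]
    rcases le_total 0 (a i) with h | h
    · rw [negPart_eq_zero.mpr h, mul_zero]
    · rw [posPart_eq_zero.mpr h, zero_mul]
  have h1 := hcross a⁺ a⁻ (posPart_nonneg a) (negPart_nonneg a) hdisj
  have h2 := hcross a⁻ a⁺ (negPart_nonneg a) (posPart_nonneg a) fun i => by
    rw [mul_comm, hdisj i]
  have hexp : eulerForm a a = eulerForm a⁺ a⁺ + eulerForm a⁻ a⁻ -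
      (eulerForm a⁺ a⁻ + eulerForm a⁻ a⁺) := by
    conv_lhs => rw [← posPart_sub_negPart a]
    simp only [map_sub, LinearMap.sub_apply]
    ring
  by_contra! hne
  have h3 := hpd a⁺ fun h => hne.2 (posPart_eq_zero.mp h)
  have h4 := hpd a⁻ fun h => hne.1 (negPart_eq_zero.mp h)
  omega

lemma exists_isSource [∀ i j : I, Finite (i ⟶ j)] [Nonempty I] (hpd : TitsPosDef I) :
    ∃ i : I, IsSource i := by
  obtain ⟨i, -, hi⟩ := hpd.exists_forall_isEmpty_hom Finset.univ Finset.univ_nonempty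
  exact ⟨i, fun j => hi j (Finset.mem_univ j)⟩

/-- If a positive root `a` satisfies `⟨a, eᵢ⟩ ≥ 2` and there is an arrow `j ⟶ i`, then the reflected
root `b = sⱼ(a)` is positive and satisfies `⟨b, eⱼ⟩ = -⟨eⱼ, a⟩ ≥ aᵢ - aⱼ ≥ 2`. -/
lemma exists_two_le_eulerForm_of_hom [DecidableEq I] [∀ i j : I, Finite (i ⟶ j)]
    (hpd : TitsPosDef I) {i j : I} (x : j ⟶ i) {a : I → ℤ} (ha : 0 ≤ a) (haa : eulerForm a a = 1)
    (hai : 2 ≤ eulerForm a (Pi.single i 1)) :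
    ∃ b : I → ℤ, 0 ≤ b ∧ eulerForm b b = 1 ∧ 2 ≤ eulerForm b (Pi.single j 1) := by
  have hone : (1 : ℤ) ≤ Nat.card (j ⟶ i) := by
    have : Nonempty (j ⟶ i) := ⟨x⟩
    exact_mod_cast Nat.one_le_iff_ne_zero.mpr Nat.card_pos.ne'
  have hji : a j + 2 ≤ a i := by
    rw [eulerForm_single_right] at hai
    have := Finset.single_le_sum (f := fun l => (Nat.card (l ⟶ i) : ℤ) * a l)
      (fun l _ => mul_nonneg (by positivity) (ha l)) (Finset.mem_univ j)
    have h2 := mul_le_mul_of_nonneg_right hone (ha j)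
    simp only [one_mul] at this h2
    linarith
  have hja : eulerForm (Pi.single j 1) a ≤ -2 := by
    rw [eulerForm_single_left]
    have := Finset.single_le_sum (f := fun l => (Nat.card (j ⟶ l) : ℤ) * a l)
      (fun l _ => mul_nonneg (by positivity) (ha l)) (Finset.mem_univ i)
    have h2 := mul_le_mul_of_nonneg_right hone (ha i)
    simp only [one_mul] at this h2
    linarith
  set m : ℤ := eulerForm a (Pi.single j 1) + eulerForm (Pi.single j 1) a with hm
  set b : I → ℤ := a - m • Pi.single j 1 with hb
  have hbj : 2 ≤ eulerForm b (Pi.single j 1) := by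
    simp only [hb, map_sub, map_smul, LinearMap.sub_apply, LinearMap.smul_apply,
      hpd.eulerForm_single_self, smul_eq_mul]
    linarith
  have hne (l : I) (hl : l ≠ j) : b l = a l := by simp [hb, hl]
  refine ⟨b, fun l => ?_, ?_, hbj⟩
  · rcases eq_or_ne l j with rfl | hl
    · rw [eulerForm_single_right] at hbj
      have : 0 ≤ ∑ y, (Nat.card (y ⟶ l) : ℤ) * b y := Finset.sum_nonneg fun y _ => by
        rcases eq_or_ne y l with rfl | hy
        · simp [hpd.card_loop_eq_zero]
        · exact mul_nonneg (by positivity) (by rw [hne y hy]; exact ha y)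
      simp only [Pi.zero_apply]
      linarith
    · rw [hne l hl]; exact ha l
  · simp only [hb, map_sub, map_smul, LinearMap.sub_apply, LinearMap.smul_apply,
      hpd.eulerForm_single_self, smul_eq_mul, haa]
    rw [hm]
    ring

/-- If the coefficients of all positive roots at the sources are at most `1`, then `⟨a, eᵢ⟩ ≤ 1`
for all positive roots `a` and all vertices `i`: a violation could be moved backwards along the arrows until it reaches a source. -/
lemma eulerForm_single_le_one [DecidableEq I] [∀ i j : I, Finite (i ⟶ j)] (hpd : TitsPosDef I)
    (hsource : ∀ i : I, IsSource i → ∀ a : I → ℤ, 0 ≤ a → eulerForm a a = 1 → a i ≤ 1)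
    (i : I) {a : I → ℤ} (ha : 0 ≤ a) (haa : eulerForm a a = 1) :
    eulerForm a (Pi.single i 1) ≤ 1 := by
  classical
  by_contra! hlt
  let B : Finset I := {j | ∃ b : I → ℤ, 0 ≤ b ∧ eulerForm b b = 1 ∧ 2 ≤ eulerForm b (Pi.single j 1)}
  obtain ⟨j, hj, hjB⟩ := hpd.exists_forall_isEmpty_hom B ⟨i, by
    simp only [B, Finset.mem_filter, Finset.mem_univ, true_and]
    exact ⟨a, ha, haa, hlt⟩⟩
  simp only [B, Finset.mem_filter, Finset.mem_univ, true_and] at hj hjB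
  obtain ⟨b, hb, hbb, hbj⟩ := hj
  have hsrc : IsSource j := fun l => ⟨fun x =>
    (hjB l (hpd.exists_two_le_eulerForm_of_hom x hb hbb hbj)).false x⟩
  have hbj1 := hsource j hsrc b hb hbb
  rw [eulerForm_single_right] at hbj
  have : 0 ≤ ∑ y, (Nat.card (y ⟶ j) : ℤ) * b y :=
    Finset.sum_nonneg fun y _ => mul_nonneg (by positivity) (hb y)
  linarith

end TitsPosDef

end EulerForm

/-! ### Morphisms and extensions of representations -/

namespace Rep

section Basic

variable {k : Type u} [Field k] {I : Type v} [Quiver.{w} I]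

lemma mem_Hom_iff {X Y : Rep k I} {f : ∀ i, X.V i →ₗ[k] Y.V i} :
    f ∈ Hom X Y ↔ ∀ (i j : I) (a : i ⟶ j) (x : X.V i), f j (X.map a x) = Y.map a (f i x) :=
  ⟨fun h i j a x => LinearMap.congr_fun (h i j a) x,
    fun h i j a => LinearMap.ext fun x => h i j a x⟩

lemma Hom.naturality {X Y : Rep k I} (f : Hom X Y) {i j : I} (a : i ⟶ j) (x : X.V i) :
    f.1 j (X.map a x) = Y.map a (f.1 i x) :=
  mem_Hom_iff.mp f.2 i j a x

/-- Composition of morphisms of representations, as a bilinear map. -/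
def Hom.comp {X Y Z : Rep k I} : Hom Y Z →ₗ[k] Hom X Y →ₗ[k] Hom X Z :=
  LinearMap.mk₂ k
    (fun g f => ⟨fun i => g.1 i ∘ₗ f.1 i, mem_Hom_iff.mpr fun i j a x => by
      simp [Hom.naturality]⟩)
    (fun _ _ _ => by ext; simp) (fun _ _ _ => by ext; simp)
    (fun _ _ _ => by ext; simp) (fun _ _ _ => by ext; simp)

@[simp]
lemma Hom.comp_apply {X Y Z : Rep k I} (g : Hom Y Z) (f : Hom X Y) (i : I) (x : X.V i) :
    (Hom.comp g f).1 i x = g.1 i (f.1 i x) :=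
  rfl

/-- The identity morphism. -/
def Hom.id (X : Rep k I) : Hom X X :=
  ⟨fun _ => LinearMap.id, fun _ _ _ => rfl⟩

lemma Hom.ext_apply {X Y : Rep k I} {f g : Hom X Y} (h : ∀ i x, f.1 i x = g.1 i x) : f = g :=
  Subtype.ext (funext fun i => LinearMap.ext (h i))

/-- The differential of the complex computing `Hom(X, Y)` (the kernel) and `Ext¹(X, Y)` (the
cokernel): a family `f` of linear maps at the vertices is sent to its failure to commute with the
maps along the arrows. -/
def coboundary (X Y : Rep k I) :
    (∀ i, X.V i →ₗ[k] Y.V i) →ₗ[k] (∀ i j : I, (i ⟶ j) → (X.V i →ₗ[k] Y.V j)) where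
  toFun f := fun i j a => f j ∘ₗ X.map a - Y.map a ∘ₗ f i
  map_add' f g := by
    funext i j a
    ext x
    simp only [Pi.add_apply, LinearMap.sub_apply, LinearMap.comp_apply, LinearMap.add_apply,
      map_add]
    abel
  map_smul' c f := by
    funext i j a
    ext x
    simp [smul_sub]

@[simp]
lemma coboundary_apply (X Y : Rep k I) (f : ∀ i, X.V i →ₗ[k] Y.V i) {i j : I} (a : i ⟶ j)
    (x : X.V i) : coboundary X Y f i j a x = f j (X.map a x) - Y.map a (f i x) :=
  rfl

lemma ker_coboundary (X Y : Rep k I) : LinearMap.ker (coboundary X Y) = Hom X Y := by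
  ext f
  rw [LinearMap.mem_ker, mem_Hom_iff]
  constructor
  · intro h i j a x
    have := LinearMap.congr_fun (congrFun (congrFun (congrFun h i) j) a) x
    simpa [sub_eq_zero] using this
  · intro h
    funext i j a
    ext x
    simp [h i j a x]

/-- The vanishing of `Ext¹(X, Y)`. -/
def ExtVanishes (X Y : Rep k I) : Prop :=
  Function.Surjective (coboundary X Y)

/-- `Ext¹(Z, -)` is right exact. -/
lemma ExtVanishes.of_surjective_right {X Y Z : Rep k I} (h : ExtVanishes Z X) (φ : Hom X Y)
    (hφ : ∀ i, Function.Surjective (φ.1 i)) : ExtVanishes Z Y := by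
  intro g
  choose s hs using fun i => (φ.1 i).exists_rightInverse_of_surjective
    (LinearMap.range_eq_top.mpr (hφ i))
  obtain ⟨f, hf⟩ := h fun i j a => s j ∘ₗ g i j a
  refine ⟨fun i => φ.1 i ∘ₗ f i, ?_⟩
  funext i j a
  ext x
  have h1 := congrArg (φ.1 j) (LinearMap.congr_fun (congrFun (congrFun (congrFun hf i) j) a) x)
  have h2 : φ.1 j (s j (g i j a x)) = g i j a x := LinearMap.congr_fun (hs j) _
  simp only [coboundary_apply, LinearMap.comp_apply, map_sub, h2] at h1 ⊢
  rw [← h1, Hom.naturality φ]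

/-- The dimension vector of a representation. -/
noncomputable def dimVec (X : Rep k I) : I → ℤ := fun i => Module.finrank k (X.V i)

lemma dimVec_nonneg (X : Rep k I) : 0 ≤ X.dimVec := fun _ => Int.natCast_nonneg _

variable [Fintype I]

/-- The total dimension of a representation. -/
noncomputable def totalDim (X : Rep k I) : ℕ := ∑ i, Module.finrank k (X.V i)

/-- The dimension of `Ext¹(X, Y)`. -/
noncomputable def extDim (X Y : Rep k I) : ℕ :=
  Module.finrank k ((∀ i j : I, (i ⟶ j) → (X.V i →ₗ[k] Y.V j)) ⧸ LinearMap.range (coboundary X Y))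

variable [∀ i j : I, Finite (i ⟶ j)]

/-- `Ext¹` is defined by a complex of finite-dimensional spaces whose Euler characteristic is given
by the Euler form. -/
lemma finrank_Hom_sub_extDim {X Y : Rep k I} (hX : X.IsFiniteDimensional)
    (hY : Y.IsFiniteDimensional) :
    (Module.finrank k (Hom X Y) : ℤ) - extDim X Y = eulerForm X.dimVec Y.dimVec := by
  have : ∀ i, FiniteDimensional k (X.V i) := hX
  have : ∀ i, FiniteDimensional k (Y.V i) := hY
  have (i j : I) : Fintype (i ⟶ j) := Fintype.ofFinite _
  have h1 := (coboundary X Y).finrank_range_add_finrank_ker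
  have h2 := (LinearMap.range (coboundary X Y)).finrank_quotient_add_finrank
  rw [ker_coboundary] at h1
  rw [← extDim] at h2
  have h3 : (Module.finrank k (∀ i, X.V i →ₗ[k] Y.V i) : ℤ) = ∑ i, X.dimVec i * Y.dimVec i := by
    rw [Module.finrank_pi_fintype]
    simp [Module.finrank_linearMap, dimVec]
  have h4 : (Module.finrank k (∀ i j : I, (i ⟶ j) → (X.V i →ₗ[k] Y.V j)) : ℤ) =
      ∑ i, ∑ j, (Nat.card (i ⟶ j) : ℤ) * (X.dimVec i * Y.dimVec j) := by
    rw [Module.finrank_pi_fintype, Nat.cast_sum]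
    refine Finset.sum_congr rfl fun i _ => ?_
    rw [Module.finrank_pi_fintype, Nat.cast_sum]
    refine Finset.sum_congr rfl fun j _ => ?_
    rw [Module.finrank_pi_fintype]
    simp [Module.finrank_linearMap, dimVec, Nat.card_eq_fintype_card]
  rw [eulerForm_apply, ← h3, ← h4]
  omega

lemma extVanishes_iff_extDim_eq_zero {X Y : Rep k I} (hX : X.IsFiniteDimensional)
    (hY : Y.IsFiniteDimensional) : ExtVanishes X Y ↔ extDim X Y = 0 := by
  have : ∀ i, FiniteDimensional k (X.V i) := hX
  have : ∀ i, FiniteDimensional k (Y.V i) := hY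
  have (i j : I) : Fintype (i ⟶ j) := Fintype.ofFinite _
  rw [extDim, Module.finrank_zero_iff, Submodule.Quotient.subsingleton_iff,
    LinearMap.range_eq_top, ExtVanishes]

end Basic

section Subrep

variable {k : Type u} [Field k] {I : Type v} [Quiver.{w} I]

/-- A subrepresentation, as a representation. -/
def sub (X : Rep k I) (U : ∀ i, Submodule k (X.V i)) (hU : X.IsSubrep U) : Rep k I where
  V i := U i
  map {i j} a := (X.map a).restrict (hU i j a)

/-- The inclusion of a subrepresentation. -/
def subIncl (X : Rep k I) (U : ∀ i, Submodule k (X.V i)) (hU : X.IsSubrep U) :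
    Hom (X.sub U hU) X :=
  ⟨fun i => (U i).subtype, fun _ _ _ => rfl⟩

/-- A vector of a subrepresentation. -/
def subMk (X : Rep k I) (U : ∀ i, Submodule k (X.V i)) (hU : X.IsSubrep U) {i : I} {x : X.V i}
    (hx : x ∈ U i) : (X.sub U hU).V i :=
  (⟨x, hx⟩ : U i)

lemma IsFiniteDimensional.sub {X : Rep k I} (hX : X.IsFiniteDimensional)
    (U : ∀ i, Submodule k (X.V i)) (hU : X.IsSubrep U) : (X.sub U hU).IsFiniteDimensional := by
  intro i
  have := hX i
  exact inferInstanceAs (FiniteDimensional k (U i))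

lemma isSubrep_ker {X Y : Rep k I} (f : Hom X Y) :
    X.IsSubrep fun i => LinearMap.ker (f.1 i) := by
  intro i j a x hx
  rw [LinearMap.mem_ker] at hx ⊢
  rw [Hom.naturality f, hx, map_zero]

lemma isSubrep_range {X Y : Rep k I} (f : Hom X Y) :
    Y.IsSubrep fun i => LinearMap.range (f.1 i) := by
  rintro i j a _ ⟨x, rfl⟩
  exact ⟨X.map a x, Hom.naturality f a x⟩

lemma IsSubrep.sup {X : Rep k I} {U W : ∀ i, Submodule k (X.V i)} (hU : X.IsSubrep U)
    (hW : X.IsSubrep W) : X.IsSubrep fun i => U i ⊔ W i := by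
  intro i j a x hx
  obtain ⟨y, hy, z, hz, rfl⟩ := Submodule.mem_sup.mp hx
  rw [map_add]
  exact Submodule.add_mem_sup (hU i j a y hy) (hW i j a z hz)

lemma isSubrep_bot (X : Rep k I) : X.IsSubrep fun _ => ⊥ := by
  intro i j a x hx
  rw [Submodule.mem_bot] at hx ⊢
  rw [hx, map_zero]

lemma IsSubrep.map_subtype {X : Rep k I} {U : ∀ i, Submodule k (X.V i)} (hU : X.IsSubrep U)
    {T : ∀ i, Submodule k (U i)} (hT : (X.sub U hU).IsSubrep T) :
    X.IsSubrep fun i => (T i).map (U i).subtype := by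
  rintro i j a _ ⟨y, hy, rfl⟩
  exact ⟨(X.sub U hU).map a y, hT i j a y hy, rfl⟩

end Subrep

end Rep

/-! ### Ringel's lemma -/

lemma exists_comp_eq_of_ker_le {k V W T : Type*} [Field k] [AddCommGroup V] [Module k V]
    [AddCommGroup W] [Module k W] [AddCommGroup T] [Module k T] (β : V →ₗ[k] W) (g : V →ₗ[k] T)
    (h : LinearMap.ker β ≤ LinearMap.ker g) : ∃ f : W →ₗ[k] T, f ∘ₗ β = g := by
  obtain ⟨s, hs⟩ := β.rangeRestrict.exists_rightInverse_of_surjective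
    (LinearMap.range_rangeRestrict β)
  obtain ⟨f, hf⟩ := LinearMap.exists_extend (g ∘ₗ s)
  refine ⟨f, LinearMap.ext fun x => ?_⟩
  have h1 : f (β x) = g (s (β.rangeRestrict x)) := LinearMap.congr_fun hf (β.rangeRestrict x)
  have h2 : β (s (β.rangeRestrict x)) = β x :=
    congrArg Subtype.val (LinearMap.congr_fun hs (β.rangeRestrict x))
  have h3 : s (β.rangeRestrict x) - x ∈ LinearMap.ker g := h (by
    rw [LinearMap.mem_ker, map_sub, h2, sub_self])
  rw [LinearMap.mem_ker, map_sub, sub_eq_zero] at h3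
  rw [LinearMap.comp_apply, h1, h3]

namespace Rep

section Brick

variable {k : Type u} [Field k] {I : Type v} [Quiver.{w} I]

/-- Let `Y` be rigid and `β : X ⟶ Y` a morphism. A family of linear maps `X ⟶ Y` which commutes
with the arrows on `ker β` can be changed outside `ker β` to a morphism. In other words, morphisms
`ker β ⟶ Y` extend to `X`. -/
lemma ExtVanishes.exists_hom_eq_on_ker {X Y : Rep k I} (hY : ExtVanishes Y Y) (β : Hom X Y)
    (p : ∀ i, X.V i →ₗ[k] Y.V i)
    (hp : ∀ (i j : I) (a : i ⟶ j) (x : X.V i), β.1 i x = 0 → p j (X.map a x) = Y.map a (p i x)) :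
    ∃ r : Hom X Y, ∀ i x, β.1 i x = 0 → r.1 i x = p i x := by
  have hfac (i j : I) (a : i ⟶ j) :
      ∃ h : Y.V i →ₗ[k] Y.V j, h ∘ₗ β.1 i = coboundary X Y p i j a :=
    exists_comp_eq_of_ker_le _ _ fun x hx => by
      rw [LinearMap.mem_ker] at hx ⊢
      rw [coboundary_apply, hp i j a x hx, sub_self]
  choose h hh using hfac
  obtain ⟨f, hf⟩ := hY h
  refine ⟨⟨fun i => p i - f i ∘ₗ β.1 i, mem_Hom_iff.mpr fun i j a x => ?_⟩, fun i x hx => by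
    simp [hx]⟩
  have h1 := LinearMap.congr_fun (hh i j a) x
  rw [← hf] at h1
  simp only [LinearMap.comp_apply, coboundary_apply] at h1
  simp only [LinearMap.sub_apply, LinearMap.comp_apply, Hom.naturality, map_sub]
  rw [sub_eq_sub_iff_add_eq_add] at h1 ⊢
  rw [← h1, add_comm]

/-- A representation is a brick if every nonzero endomorphism is an automorphism. -/
def IsBrick (X : Rep k I) : Prop :=
  ∀ f : Hom X X, f ≠ 0 → ∀ i, Function.Bijective (f.1 i)

variable [Fintype I]

/-- The rank of a morphism. -/
noncomputable def Hom.rank {X Y : Rep k I} (f : Hom X Y) : ℕ :=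
  ∑ i, Module.finrank k (LinearMap.range (f.1 i))

/-- In an indecomposable representation, a nonzero endomorphism of minimal rank among those which
are not automorphisms squares to zero: otherwise its square would have the same rank, and its
kernel and its image would be complementary. -/
lemma IsIndecomposable.comp_self_eq_zero {X : Rep k I} (hX : X.IsFiniteDimensional)
    (hind : X.IsIndecomposable) {θ : Hom X X} (hθ : θ ≠ 0)
    (hbij : ∃ i, ¬ Function.Bijective (θ.1 i))
    (hmin : ∀ f : Hom X X, f ≠ 0 → (∃ i, ¬ Function.Bijective (f.1 i)) → Hom.rank θ ≤ Hom.rank f) :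
    Hom.comp θ θ = 0 := by
  have : ∀ i, FiniteDimensional k (X.V i) := hX
  by_contra hne
  obtain ⟨i₀, hi₀⟩ := hbij
  have hinj₀ : ¬ Function.Injective (θ.1 i₀) := fun h =>
    hi₀ ⟨h, LinearMap.injective_iff_surjective.mp h⟩
  have hrank := hmin _ hne ⟨i₀, fun h => hinj₀ fun x y hxy => h.1 (by simp [hxy])⟩
  have hle (i : I) : Module.finrank k (LinearMap.range ((Hom.comp θ θ).1 i)) ≤
      Module.finrank k (LinearMap.range (θ.1 i)) :=
    Submodule.finrank_mono (by rintro _ ⟨x, rfl⟩; exact ⟨θ.1 i x, rfl⟩)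
  have heq (i : I) : Module.finrank k (LinearMap.range ((Hom.comp θ θ).1 i)) =
      Module.finrank k (LinearMap.range (θ.1 i)) :=
    (Finset.sum_eq_sum_iff_of_le fun i _ => hle i).mp
      (le_antisymm (Finset.sum_le_sum fun i _ => hle i) hrank) i (Finset.mem_univ i)
  have hker (i : I) : LinearMap.ker (θ.1 i) = LinearMap.ker ((Hom.comp θ θ).1 i) := by
    refine Submodule.eq_of_le_of_finrank_eq (fun x hx => ?_) ?_
    · rw [LinearMap.mem_ker] at hx ⊢
      simp [hx]
    · have h1 := (θ.1 i).finrank_range_add_finrank_ker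
      have h2 := ((Hom.comp θ θ).1 i).finrank_range_add_finrank_ker
      have h3 := heq i
      omega
  have hcompl (i : I) : IsCompl (LinearMap.ker (θ.1 i)) (LinearMap.range (θ.1 i)) := by
    refine (Submodule.isCompl_iff_disjoint _ _ ?_).mpr ?_
    · rw [add_comm, (θ.1 i).finrank_range_add_finrank_ker]
    · rw [Submodule.disjoint_def]
      rintro _ hx ⟨y, rfl⟩
      have : y ∈ LinearMap.ker (θ.1 i) := by
        rw [hker i, LinearMap.mem_ker]
        exact hx
      exact this
  rcases hind.2 _ _ (isSubrep_ker θ) (isSubrep_range θ) hcompl with h | h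
  · exact hinj₀ (LinearMap.ker_eq_bot.mp (h i₀))
  · refine hθ (Hom.ext_apply fun i x => ?_)
    rw [LinearMap.range_eq_bot.mp (h i)]
    rfl

/-- A nonzero family of subspaces `R` of a subrepresentation `K` has a nonzero projection to some
indecomposable direct summand `U` of `K`. -/
lemma exists_isIndecomposable_sub {X : Rep k I} (hX : X.IsFiniteDimensional)
    (R K : ∀ i, Submodule k (X.V i)) (hK : X.IsSubrep K) (hRK : ∀ i, R i ≤ K i)
    (hR : ∃ i, R i ≠ ⊥) :
    ∃ (U W : ∀ i, Submodule k (X.V i)) (hU : X.IsSubrep U), X.IsSubrep W ∧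
      (∀ i, Disjoint (U i) (W i)) ∧ (∀ i, U i ⊔ W i = K i) ∧ (∃ i, ¬ R i ≤ W i) ∧
      (X.sub U hU).IsIndecomposable := by
  classical
  have : ∀ i, FiniteDimensional k (X.V i) := hX
  let P (n : ℕ) : Prop := ∃ U W : ∀ i, Submodule k (X.V i), X.IsSubrep U ∧ X.IsSubrep W ∧
    (∀ i, Disjoint (U i) (W i)) ∧ (∀ i, U i ⊔ W i = K i) ∧ (∃ i, ¬ R i ≤ W i) ∧
    ∑ i, Module.finrank k (U i) = n
  have hP : ∃ n, P n := ⟨_, K, fun _ => ⊥, hK, isSubrep_bot X, fun _ => disjoint_bot_right,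
    fun _ => sup_bot_eq _, by simpa only [le_bot_iff] using hR, rfl⟩
  obtain ⟨U, W, hU, hW, hdisj, hsup, ⟨i₀, hi₀⟩, hn⟩ := Nat.find_spec hP
  refine ⟨U, W, hU, hW, hdisj, hsup, ⟨i₀, hi₀⟩, ?_⟩
  -- a direct summand `T₁` of `U` such that `R` does not lie in `T₂ ⊕ W` is all of `U`
  have hstep (T₁ T₂ : ∀ i, Submodule k (U i)) (hT₁ : (X.sub U hU).IsSubrep T₁)
      (hT₂ : (X.sub U hU).IsSubrep T₂) (hc : ∀ i, IsCompl (T₁ i) (T₂ i))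
      (hne : ¬ ∀ i, T₂ i = ⊥) (i : I) : R i ≤ (T₂ i).map (U i).subtype ⊔ W i := by
    by_contra hR'
    refine Nat.find_min hP (m := ∑ i, Module.finrank k ((T₁ i).map (U i).subtype)) ?_
      ⟨fun i => (T₁ i).map (U i).subtype, fun i => (T₂ i).map (U i).subtype ⊔ W i,
        hU.map_subtype hT₁, (hU.map_subtype hT₂).sup hW, fun i => ?_, fun i => ?_, ⟨i, hR'⟩, rfl⟩
    · rw [← hn]
      have hfin (i : I) : Module.finrank k ((T₁ i).map (U i).subtype) +
          Module.finrank k (T₂ i) = Module.finrank k (U i) := by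
        rw [(U i).finrank_map_subtype_eq, Submodule.finrank_add_eq_of_isCompl (hc i)]
      push Not at hne
      obtain ⟨j, hj⟩ := hne
      refine Finset.sum_lt_sum (fun i _ => by have := hfin i; omega) ⟨j, Finset.mem_univ j, ?_⟩
      have h1 := Submodule.one_le_finrank_iff.mpr hj
      have h2 := hfin j
      omega
    · have h1 : Disjoint ((T₁ i).map (U i).subtype) ((T₂ i).map (U i).subtype) :=
        Submodule.disjoint_map (U i).injective_subtype (hc i).disjoint
      refine h1.disjoint_sup_right_of_disjoint_sup_left ?_
      rw [← Submodule.map_sup, (hc i).sup_eq_top, Submodule.map_subtype_top]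
      exact hdisj i
    · rw [← sup_assoc, ← Submodule.map_sup, (hc i).sup_eq_top, Submodule.map_subtype_top]
      exact hsup i
  refine ⟨⟨i₀, ?_⟩, fun T₁ T₂ hT₁ hT₂ hc => ?_⟩
  · rw [← not_subsingleton_iff_nontrivial]
    intro hs
    have hbot : U i₀ = ⊥ := (Submodule.subsingleton_iff_eq_bot).mp hs
    have h := hsup i₀
    rw [hbot, bot_sup_eq] at h
    exact hi₀ (h ▸ hRK i₀)
  · by_contra! hne
    have h₂ := hstep T₁ T₂ hT₁ hT₂ hc (not_forall.mpr hne.2)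
    have h₁ := hstep T₂ T₁ hT₂ hT₁ (fun i => (hc i).symm) (not_forall.mpr hne.1)
    refine hi₀ fun x hx => ?_
    obtain ⟨_, ⟨t, ht, rfl⟩, w, hw, h⟩ := Submodule.mem_sup.mp (h₁ i₀ hx)
    obtain ⟨_, ⟨t', ht', rfl⟩, w', hw', h'⟩ := Submodule.mem_sup.mp (h₂ i₀ hx)
    simp only [Submodule.subtype_apply] at h h'
    have hsub : ((t - t' : U i₀) : X.V i₀) = w' - w := by
      rw [AddSubgroupClass.coe_sub, sub_eq_sub_iff_add_eq_add, h, add_comm, h']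
    have h0 : t - t' = 0 := Subtype.ext <| Submodule.disjoint_def.mp (hdisj i₀) _
      (t - t').2 (hsub ▸ sub_mem hw' hw)
    rw [sub_eq_zero] at h0
    have ht0 : t = 0 := Submodule.disjoint_def.mp (hc i₀).disjoint _ ht (h0 ▸ ht')
    rw [← h, ht0]
    simpa using hw

/-- **Ringel's lemma**: if all indecomposable representations smaller than the indecomposable
representation `X` are rigid, then `X` is a brick. Otherwise let `θ` be an
endomorphism as in `IsIndecomposable.comp_self_eq_zero`. Its image lies in its kernel, and projects
nontrivially, hence injectively by minimality, to an indecomposable summand `U` of the kernel. As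
`U` is rigid, the projection of the kernel to `U` extends to `X`, so that `U` is a direct summand of
`X`, contrary to indecomposability. -/
lemma IsIndecomposable.isBrick {X : Rep k I} (hX : X.IsFiniteDimensional)
    (hind : X.IsIndecomposable)
    (hsmall : ∀ Y : Rep k I, Y.IsFiniteDimensional → Y.IsIndecomposable →
      Y.totalDim < X.totalDim → ExtVanishes Y Y) : X.IsBrick := by
  classical
  have : ∀ i, FiniteDimensional k (X.V i) := hX
  by_contra hbrick
  let P (n : ℕ) : Prop := ∃ f : Hom X X, f ≠ 0 ∧ (∃ i, ¬ Function.Bijective (f.1 i)) ∧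
    Hom.rank f = n
  have hP : ∃ n, P n := by
    simp only [IsBrick, not_forall] at hbrick
    obtain ⟨f, hf, i, hi⟩ := hbrick
    exact ⟨_, f, hf, ⟨i, hi⟩, rfl⟩
  obtain ⟨θ, hθ, hbij, hn⟩ := Nat.find_spec hP
  have hmin (f : Hom X X) (hf : f ≠ 0) (hb : ∃ i, ¬ Function.Bijective (f.1 i)) :
      Hom.rank θ ≤ Hom.rank f := hn ▸ Nat.find_min' hP ⟨f, hf, hb, rfl⟩
  have hsq := hind.comp_self_eq_zero hX hθ hbij hmin
  have hsq' (i : I) (x : X.V i) : θ.1 i (θ.1 i x) = 0 :=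
    LinearMap.congr_fun (congrFun (congrArg Subtype.val hsq) i) x
  have hker_ne_top : ∃ i, LinearMap.ker (θ.1 i) ≠ ⊤ := by
    by_contra! h
    refine hθ (Hom.ext_apply fun i x => ?_)
    have : x ∈ LinearMap.ker (θ.1 i) := h i ▸ Submodule.mem_top
    exact this
  obtain ⟨U, W, hU, hW, hdisj, hsup, ⟨i₀, hi₀⟩, hUind⟩ := exists_isIndecomposable_sub hX
    (fun i => LinearMap.range (θ.1 i)) (fun i => LinearMap.ker (θ.1 i)) (isSubrep_ker θ)
    (by rintro i _ ⟨x, rfl⟩; exact hsq' i x) (by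
      by_contra! h
      exact hθ (Hom.ext_apply fun i x => by rw [LinearMap.range_eq_bot.mp (h i)]; rfl))
  have hUker (i : I) : U i ≤ LinearMap.ker (θ.1 i) := hsup i ▸ le_sup_left
  have hUrig : ExtVanishes (X.sub U hU) (X.sub U hU) := by
    refine hsmall _ (hX.sub U hU) hUind ?_
    obtain ⟨j, hj⟩ := hker_ne_top
    refine Finset.sum_lt_sum (fun i _ => (U i).finrank_le) ⟨j, Finset.mem_univ j, ?_⟩
    exact Submodule.finrank_lt fun h => hj (top_le_iff.mp (h ▸ hUker j))
  -- a linear projection to `U`, which vanishes on `W`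
  choose C hC using fun i => (hdisj i).symm.exists_isCompl
  let p : ∀ i, X.V i →ₗ[k] (X.sub U hU).V i :=
    fun i => (U i).projectionOnto (C i) (hC i).2.symm
  have hpU (i : I) (x : X.V i) (hx : x ∈ U i) : p i x = subMk X U hU hx :=
    Submodule.projectionOnto_apply_of_mem_left _ hx
  have hpW (i : I) (x : X.V i) (hx : x ∈ W i) : p i x = 0 :=
    Submodule.projectionOnto_apply_of_mem_right _ ((hC i).1 hx)
  have hpcomm (i j : I) (a : i ⟶ j) (x : X.V i) (hx : θ.1 i x = 0) :
      p j (X.map a x) = (X.sub U hU).map a (p i x) := by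
    have hx' : x ∈ U i ⊔ W i := hsup i ▸ hx
    obtain ⟨u, hu, w, hw, rfl⟩ := Submodule.mem_sup.mp hx'
    rw [map_add, map_add, map_add, hpU i u hu, hpW i w hw, hpU j _ (hU i j a u hu),
      hpW j _ (hW i j a w hw), add_zero, add_zero]
    rfl
  let β : Hom X (X.sub U hU) := ⟨fun i => p i ∘ₗ θ.1 i, mem_Hom_iff.mpr fun i j a x => by
    rw [LinearMap.comp_apply, Hom.naturality, hpcomm i j a _ (hsq' i x), LinearMap.comp_apply]⟩
  have hβ (i : I) (x : X.V i) : β.1 i x = p i (θ.1 i x) := rfl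
  let f : Hom X X := Hom.comp (subIncl X U hU) β
  have hf (i : I) : f.1 i = ((subIncl X U hU).1 i ∘ₗ p i) ∘ₗ θ.1 i := rfl
  have hf0 : f ≠ 0 := by
    intro h0
    refine hi₀ ?_
    rintro _ ⟨x, rfl⟩
    have hx' : θ.1 i₀ x ∈ U i₀ ⊔ W i₀ := hsup i₀ ▸ hsq' i₀ x
    obtain ⟨u, hu, w, hw, h⟩ := Submodule.mem_sup.mp hx'
    have h1 : f.1 i₀ x = u := by
      rw [hf, LinearMap.comp_apply, LinearMap.comp_apply, ← h, map_add, hpU i₀ u hu, hpW i₀ w hw,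
        add_zero]
      rfl
    rw [h0] at h1
    have hu0 : u = 0 := h1.symm
    rw [← h, hu0, zero_add]
    exact hw
  have hfU (i : I) (x : X.V i) : f.1 i x ∈ U i := (β.1 i x : U i).2
  have hle (i : I) : Module.finrank k (LinearMap.range (f.1 i)) ≤
      Module.finrank k (LinearMap.range (θ.1 i)) := by
    rw [hf, LinearMap.range_comp]
    exact Submodule.finrank_map_le _ _
  have hrank : Hom.rank θ ≤ Hom.rank f := by
    obtain ⟨j, hj⟩ := hker_ne_top
    refine hmin f hf0 ⟨j, fun hb => hj (top_le_iff.mp fun x _ => hUker j ?_)⟩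
    obtain ⟨y, rfl⟩ := hb.2 x
    exact hfU j y
  have heq (i : I) : Module.finrank k (LinearMap.range (f.1 i)) =
      Module.finrank k (LinearMap.range (θ.1 i)) :=
    (Finset.sum_eq_sum_iff_of_le fun i _ => hle i).mp
      (le_antisymm (Finset.sum_le_sum fun i _ => hle i) hrank) i (Finset.mem_univ i)
  have hker (i : I) : LinearMap.ker (θ.1 i) = LinearMap.ker (f.1 i) := by
    refine Submodule.eq_of_le_of_finrank_eq (fun x hx => ?_) ?_
    · rw [LinearMap.mem_ker] at hx ⊢
      rw [hf, LinearMap.comp_apply, hx, map_zero]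
    · have h1 := (θ.1 i).finrank_range_add_finrank_ker
      have h2 := (f.1 i).finrank_range_add_finrank_ker
      have h3 := heq i
      omega
  have hβθ (i : I) (x : X.V i) : β.1 i x = 0 ↔ θ.1 i x = 0 := by
    refine ⟨fun h => ?_, fun h => by rw [hβ, h, map_zero]⟩
    have : x ∈ LinearMap.ker (f.1 i) := by
      rw [LinearMap.mem_ker, Hom.comp_apply, h, map_zero]
    rw [← hker i] at this
    exact this
  obtain ⟨r, hr⟩ := hUrig.exists_hom_eq_on_ker β p fun i j a x hx =>
    hpcomm i j a x ((hβθ i x).mp hx)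
  have hcompl (i : I) : IsCompl (U i) (LinearMap.ker (r.1 i)) :=
    LinearMap.isCompl_of_proj (f := (r.1 i : X.V i →ₗ[k] U i)) fun x => by
      have h1 := hr i x.1 ((hβθ i _).mpr (hUker i x.2))
      exact h1.trans (hpU i x.1 x.2)
  rcases hind.2 U _ hU (isSubrep_ker r) hcompl with h | h
  · refine hi₀ ?_
    rintro _ ⟨x, rfl⟩
    have hx' : θ.1 i₀ x ∈ U i₀ ⊔ W i₀ := hsup i₀ ▸ hsq' i₀ x
    rwa [h i₀, bot_sup_eq] at hx'
  · obtain ⟨j, hj⟩ := hker_ne_top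
    have htop := (hcompl j).sup_eq_top
    rw [h j, sup_bot_eq] at htop
    exact hj (top_le_iff.mp (htop ▸ hUker j))

end Brick

/-! ### Indecomposable representations are rigid -/

section Endomorphisms

variable {k : Type u} [Field k] {I : Type v} [Quiver.{w} I]

/-- The endomorphism algebra of a representation. -/
def endAlgebra (X : Rep k I) : Subalgebra k (∀ i, Module.End k (X.V i)) where
  carrier := Hom X X
  mul_mem' {f g} hf hg := (Hom.comp (⟨f, hf⟩ : Hom X X) (⟨g, hg⟩ : Hom X X)).2
  add_mem' hf hg := add_mem hf hg
  algebraMap_mem' c := mem_Hom_iff.mpr fun i j a x => by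
    simp [Module.algebraMap_end_apply]

/-- The endomorphism algebra of a brick is a division algebra, over which the space at each vertex
is a vector space. -/
lemma IsBrick.finrank_Hom_dvd {X : Rep k I} (hX : X.IsFiniteDimensional) [Finite I]
    (hb : X.IsBrick) (hne : ∃ i, Nontrivial (X.V i)) (i : I) :
    Module.finrank k (Hom X X) ∣ Module.finrank k (X.V i) := by
  have : ∀ i, FiniteDimensional k (X.V i) := hX
  obtain ⟨i₀, hi₀⟩ := hne
  have hnt : Nontrivial (endAlgebra X) := by
    refine ⟨0, 1, fun h => ?_⟩
    obtain ⟨x, hx⟩ := exists_ne (0 : X.V i₀)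
    have h1 : (0 : X.V i₀) = x := LinearMap.congr_fun (congrFun (congrArg Subtype.val h) i₀) x
    exact hx h1.symm
  have hdom : NoZeroDivisors (endAlgebra X) := by
    refine ⟨fun {f g} hfg => ?_⟩
    by_contra! hne
    refine hne.2 (Subtype.ext (funext fun i => LinearMap.ext fun x => ?_))
    have hf : (⟨f.1, f.2⟩ : Hom X X) ≠ 0 := fun h => hne.1 (Subtype.ext (congrArg Subtype.val h))
    have h1 : f.1 i (g.1 i x) = 0 := LinearMap.congr_fun (congrFun (congrArg Subtype.val hfg) i) x
    exact (hb _ hf i).1 (h1.trans (map_zero _).symm)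
  have : IsDomain (endAlgebra X) := NoZeroDivisors.to_isDomain _
  let _ : DivisionRing (endAlgebra X) := divisionRingOfFiniteDimensional k (endAlgebra X)
  let _ : Module (endAlgebra X) (X.V i) :=
    Module.compHom (X.V i) ((Pi.evalRingHom _ i).comp (endAlgebra X).val.toRingHom)
  have : IsScalarTower k (endAlgebra X) (X.V i) := ⟨fun c f x => rfl⟩
  exact ⟨_, (Module.finrank_mul_finrank k (endAlgebra X) (X.V i)).symm⟩

lemma dimVec_ne_zero {X : Rep k I} (hX : X.IsFiniteDimensional)
    (hne : ∃ i, Nontrivial (X.V i)) : X.dimVec ≠ 0 := by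
  obtain ⟨i, hi⟩ := hne
  have := hX i
  intro h
  have h1 : (Module.finrank k (X.V i) : ℤ) = 0 := congrFun h i
  have h2 : 0 < Module.finrank k (X.V i) := Module.finrank_pos
  omega

variable [Fintype I] [∀ i j : I, Finite (i ⟶ j)]

/-- The endomorphism ring `D` of a brick `X` is a division ring acting on `Ext¹(X, X)`, so that
`Ext¹(X, X) ≠ 0` would imply `dim Ext¹(X, X) ≥ dim D`. -/
lemma IsBrick.extVanishes {X : Rep k I} (hX : X.IsFiniteDimensional) (hpd : TitsPosDef I)
    (hb : X.IsBrick) (hne : ∃ i, Nontrivial (X.V i)) : ExtVanishes X X := by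
  have : ∀ i, FiniteDimensional k (X.V i) := hX
  have (i j : I) : Fintype (i ⟶ j) := Fintype.ofFinite _
  by_contra hext
  obtain ⟨g, hg⟩ := not_forall.mp hext
  let Φ₀ : Hom X X →ₗ[k] (∀ i j : I, (i ⟶ j) → (X.V i →ₗ[k] X.V j)) :=
    { toFun := fun f i j a => f.1 j ∘ₗ g i j a
      map_add' := fun _ _ => rfl
      map_smul' := fun _ _ => rfl }
  let Φ := (LinearMap.range (coboundary X X)).mkQ ∘ₗ Φ₀
  have hinj : Function.Injective Φ := by
    rw [← LinearMap.ker_eq_bot, LinearMap.ker_eq_bot']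
    intro f hf
    by_contra hf0
    have hf' : Φ₀ f ∈ LinearMap.range (coboundary X X) :=
      (Submodule.Quotient.mk_eq_zero _).mp hf
    obtain ⟨h, hh⟩ := hf'
    let e (i : I) := LinearEquiv.ofBijective (f.1 i) (hb f hf0 i)
    have he (i : I) (x : X.V i) : f.1 i ((e i).symm x) = x := (e i).apply_symm_apply x
    refine hg ⟨fun i => (e i).symm.toLinearMap ∘ₗ h i, ?_⟩
    funext i j a
    ext x
    apply (hb f hf0 j).1
    have h1 := LinearMap.congr_fun (congrFun (congrFun (congrFun hh i) j) a) x
    simp only [coboundary_apply, LinearMap.comp_apply, LinearEquiv.coe_coe, map_sub,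
      Hom.naturality, he] at h1 ⊢
    exact h1
  have h1 := LinearMap.finrank_le_finrank_of_injective hinj
  have h2 := finrank_Hom_sub_extDim hX hX
  have h3 := hpd _ (dimVec_ne_zero hX hne)
  rw [extDim] at h2
  omega

/-- Indecomposable representations are rigid. -/
lemma IsIndecomposable.extVanishes {X : Rep k I} (hX : X.IsFiniteDimensional)
    (hpd : TitsPosDef I) (hind : X.IsIndecomposable) : ExtVanishes X X := by
  induction hn : X.totalDim using Nat.strong_induction_on generalizing X with
  | _ n ih =>
    exact (hind.isBrick hX fun Y hY hYind hlt =>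
      ih _ (hn ▸ hlt) hY hYind rfl).extVanishes hX hpd hind.1

/-- The dimension vector of an indecomposable representation is a root. -/
lemma IsIndecomposable.eulerForm_dimVec_self {X : Rep k I} (hX : X.IsFiniteDimensional)
    (hpd : TitsPosDef I) (hind : X.IsIndecomposable) : eulerForm X.dimVec X.dimVec = 1 := by
  have hb : X.IsBrick := hind.isBrick hX fun Y hY hYind _ => hYind.extVanishes hY hpd
  have h1 := finrank_Hom_sub_extDim hX hX
  rw [(extVanishes_iff_extDim_eq_zero hX hX).mp (hind.extVanishes hX hpd), Nat.cast_zero,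
    sub_zero] at h1
  have hpos := hpd _ (dimVec_ne_zero hX hind.1)
  choose b hb using fun i => hb.finrank_Hom_dvd hX hind.1 i
  set d := Module.finrank k (Hom X X)
  have hdim : X.dimVec = (d : ℤ) • fun i => (b i : ℤ) := by
    funext i
    simp [dimVec, hb i]
  rw [← h1] at hpos ⊢
  rw [hdim, map_smul, LinearMap.map_smul₂, smul_eq_mul, smul_eq_mul] at h1
  have h2 := mul_left_cancel₀ hpos.ne' ((mul_one _).trans h1)
  exact Int.eq_one_of_mul_eq_one_right hpos.le h2.symm

end Endomorphisms

/-! ### Morphisms to simple representations -/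

section Simple

variable {k : Type u} [Field k] {I : Type v} [Quiver.{w} I]

lemma isFiniteDimensional_simple (i : I) : (simple k i).IsFiniteDimensional := by
  classical
  intro j
  exact inferInstanceAs
    (FiniteDimensional k (if j = i then (⊤ : Submodule k k) else ⊥ : Submodule k k))

lemma dimVec_simple [DecidableEq I] (i : I) : (simple k i).dimVec = Pi.single i 1 := by
  funext j
  by_cases h : j = i
  · have hV : @ite _ (j = i) (Classical.propDecidable _) (⊤ : Submodule k k) ⊥ = ⊤ := if_pos h
    change (Module.finrank k
      (@ite _ (j = i) (Classical.propDecidable _) (⊤ : Submodule k k) ⊥ : Submodule k k) : ℤ) = _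
    rw [hV, finrank_top, Module.finrank_self, h, Pi.single_eq_same, Nat.cast_one]
  · have hV : @ite _ (j = i) (Classical.propDecidable _) (⊤ : Submodule k k) ⊥ = ⊥ := if_neg h
    change (Module.finrank k
      (@ite _ (j = i) (Classical.propDecidable _) (⊤ : Submodule k k) ⊥ : Submodule k k) : ℤ) = _
    rw [hV, finrank_bot, Pi.single_eq_of_ne h, Nat.cast_zero]

/-- A nonzero morphism from a rigid representation to `S(i)` is surjective, so that
`Ext¹(X, S(i)) = 0`. -/
lemma ExtVanishes.simple_right {X : Rep k I} (h : ExtVanishes X X) {i : I}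
    (φ : Hom X (simple k i)) (hφ : φ ≠ 0) : ExtVanishes X (simple k i) := by
  classical
  refine h.of_surjective_right φ fun j => ?_
  have hdim (j : I) : Module.finrank k ((simple k i).V j) = if j = i then 1 else 0 := by
    have := congrFun (dimVec_simple (k := k) i) j
    simp only [dimVec, Pi.single_apply] at this
    split_ifs at this ⊢ <;> exact_mod_cast this
  have hfd := isFiniteDimensional_simple (k := k) i
  have hsub (l : I) (hl : l ≠ i) : Subsingleton ((simple k i).V l) := by
    have := hfd l
    rw [← Module.finrank_zero_iff (R := k), hdim, if_neg hl]
  by_cases hj : j = i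
  · subst hj
    refine surjective_of_nonzero_of_finrank_eq_one (by rw [hdim, if_pos rfl]) (fun h0 => hφ ?_)
    refine Hom.ext_apply fun l x => ?_
    by_cases hl : l = j
    · subst hl
      rw [h0]
      rfl
    · have := hsub l hl
      exact Subsingleton.elim _ _
  · have := hsub j hj
    exact fun y => ⟨0, Subsingleton.elim _ _⟩

variable [Fintype I] [∀ i j : I, Finite (i ⟶ j)]

lemma eulerForm_le_finrank_Hom_simple [DecidableEq I] {X : Rep k I} (hX : X.IsFiniteDimensional)
    (i : I) : eulerForm X.dimVec (Pi.single i 1) ≤ Module.finrank k (Hom X (simple k i)) := by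
  have := finrank_Hom_sub_extDim hX (isFiniteDimensional_simple (k := k) i)
  rw [dimVec_simple] at this
  omega

lemma ExtVanishes.finrank_Hom_simple [DecidableEq I] {X : Rep k I} (hX : X.IsFiniteDimensional)
    (h : ExtVanishes X X) (i : I) (hne : Module.finrank k (Hom X (simple k i)) ≠ 0) :
    (Module.finrank k (Hom X (simple k i)) : ℤ) = eulerForm X.dimVec (Pi.single i 1) := by
  have hS := isFiniteDimensional_simple (k := k) i
  have : Nontrivial (Hom X (simple k i)) := 
    Module.nontrivial_of_finrank_pos (Nat.pos_of_ne_zero hne)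
  obtain ⟨φ, hφ⟩ := exists_ne (0 : Hom X (simple k i))
  have h1 := finrank_Hom_sub_extDim hX hS
  rw [(extVanishes_iff_extDim_eq_zero hX hS).mp (h.simple_right φ hφ), dimVec_simple] at h1
  omega

end Simple

/-! ### Direct sums -/

section Biprod

variable {k : Type u} [Field k] {I : Type v} [Quiver.{w} I]

lemma finiteDimensional_Hom [Finite I] {X Y : Rep k I} (hX : X.IsFiniteDimensional)
    (hY : Y.IsFiniteDimensional) : FiniteDimensional k (Hom X Y) := by
  have : ∀ i, FiniteDimensional k (X.V i) := hX
  have : ∀ i, FiniteDimensional k (Y.V i) := hY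
  infer_instance

/-- The data exhibiting `X` as the direct sum of `A` and `B`. -/
structure Biprod (X A B : Rep k I) where
  /-- the inclusion of the first summand -/
  inl : Hom A X
  /-- the inclusion of the second summand -/
  inr : Hom B X
  /-- the projection to the first summand -/
  fst : Hom X A
  /-- the projection to the second summand -/
  snd : Hom X B
  fst_inl (i : I) (x : A.V i) : fst.1 i (inl.1 i x) = x
  snd_inr (i : I) (x : B.V i) : snd.1 i (inr.1 i x) = x
  snd_inl (i : I) (x : A.V i) : snd.1 i (inl.1 i x) = 0
  fst_inr (i : I) (x : B.V i) : fst.1 i (inr.1 i x) = 0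
  inl_fst_add_inr_snd (i : I) (x : X.V i) : inl.1 i (fst.1 i x) + inr.1 i (snd.1 i x) = x

attribute [simp] Biprod.fst_inl Biprod.snd_inr Biprod.snd_inl Biprod.fst_inr
  Biprod.inl_fst_add_inr_snd

namespace Biprod

variable {X A B : Rep k I}

/-- The direct sum is commutative. -/
def symm (s : Biprod X A B) : Biprod X B A where
  inl := s.inr
  inr := s.inl
  fst := s.snd
  snd := s.fst
  fst_inl := s.snd_inr
  snd_inr := s.fst_inl
  snd_inl := s.fst_inr
  fst_inr := s.snd_inl
  inl_fst_add_inr_snd i x := by rw [add_comm, s.inl_fst_add_inr_snd]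

/-- The direct sum is associative. -/
def assoc {A₁ A₂ C : Rep k I} (s : Biprod X A B) (t : Biprod A A₁ A₂) (r : Biprod C A₂ B) :
    Biprod X A₁ C where
  inl := Hom.comp s.inl t.inl
  inr := Hom.comp (Hom.comp s.inl t.inr) r.fst + Hom.comp s.inr r.snd
  fst := Hom.comp t.fst s.fst
  snd := Hom.comp r.inl (Hom.comp t.snd s.fst) + Hom.comp r.inr s.snd
  fst_inl i x := by simp
  snd_inr i x := by simp
  snd_inl i x := by simp
  fst_inr i x := by simp
  inl_fst_add_inr_snd i x := by
    have h : s.inl.1 i (t.inl.1 i (t.fst.1 i (s.fst.1 i x))) +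
        s.inl.1 i (t.inr.1 i (t.snd.1 i (s.fst.1 i x))) + s.inr.1 i (s.snd.1 i x) = x := by
      rw [← map_add, t.inl_fst_add_inr_snd, s.inl_fst_add_inr_snd]
    simpa [← add_assoc] using h

lemma isFiniteDimensional_left (s : Biprod X A B) (hX : X.IsFiniteDimensional) :
    A.IsFiniteDimensional := by
  intro i
  have := hX i
  exact FiniteDimensional.of_injective (s.inl.1 i)
    (Function.LeftInverse.injective (s.fst_inl i))

lemma dimVec_eq (s : Biprod X A B) (hX : X.IsFiniteDimensional) :
    X.dimVec = A.dimVec + B.dimVec := by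
  funext i
  have := s.isFiniteDimensional_left hX i
  have := s.symm.isFiniteDimensional_left hX i
  have e : X.V i ≃ₗ[k] A.V i × B.V i := LinearEquiv.ofLinearMap
    ((s.fst.1 i).prod (s.snd.1 i)) ((s.inl.1 i).coprod (s.inr.1 i))
    (by ext <;> simp) (by ext; simp)
  simp only [dimVec, Pi.add_apply]
  rw [e.finrank_eq, Module.finrank_prod, Nat.cast_add]

variable [Finite I]

lemma finrank_Hom_left (s : Biprod X A B) (hX : X.IsFiniteDimensional) {Y : Rep k I}
    (hY : Y.IsFiniteDimensional) : Module.finrank k (Hom X Y) =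
      Module.finrank k (Hom A Y) + Module.finrank k (Hom B Y) := by
  have := finiteDimensional_Hom (s.isFiniteDimensional_left hX) hY
  have := finiteDimensional_Hom (s.symm.isFiniteDimensional_left hX) hY
  have e : Hom X Y ≃ₗ[k] Hom A Y × Hom B Y := LinearEquiv.ofLinearMap
    ((Hom.comp.flip s.inl).prod (Hom.comp.flip s.inr))
    ((Hom.comp.flip s.fst).coprod (Hom.comp.flip s.snd))
    (by
      refine LinearMap.ext fun f => Prod.ext ?_ ?_ <;>
      · refine Hom.ext_apply fun i x => ?_
        simp)
    (by
      refine LinearMap.ext fun f => Hom.ext_apply fun i x => ?_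
      simp [← map_add])
  rw [e.finrank_eq, Module.finrank_prod]

lemma finrank_Hom_right (s : Biprod X A B) (hX : X.IsFiniteDimensional) {Y : Rep k I}
    (hY : Y.IsFiniteDimensional) : Module.finrank k (Hom Y X) =
      Module.finrank k (Hom Y A) + Module.finrank k (Hom Y B) := by
  have := finiteDimensional_Hom hY (s.isFiniteDimensional_left hX)
  have := finiteDimensional_Hom hY (s.symm.isFiniteDimensional_left hX)
  have e : Hom Y X ≃ₗ[k] Hom Y A × Hom Y B := LinearEquiv.ofLinearMap
    ((Hom.comp s.fst).prod (Hom.comp s.snd))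
    ((Hom.comp s.inl).coprod (Hom.comp s.inr))
    (by
      refine LinearMap.ext fun f => Prod.ext ?_ ?_ <;>
      · refine Hom.ext_apply fun i x => ?_
        simp)
    (by
      refine LinearMap.ext fun f => Hom.ext_apply fun i x => ?_
      simp)
  rw [e.finrank_eq, Module.finrank_prod]

end Biprod

namespace Biprod

variable [Fintype I] [∀ i j : I, Finite (i ⟶ j)] {X A B : Rep k I}

lemma extDim_left (s : Biprod X A B) (hX : X.IsFiniteDimensional) {Y : Rep k I}
    (hY : Y.IsFiniteDimensional) : extDim X Y = extDim A Y + extDim B Y := by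
  have h := finrank_Hom_sub_extDim hX hY
  have hA := finrank_Hom_sub_extDim (s.isFiniteDimensional_left hX) hY
  have hB := finrank_Hom_sub_extDim (s.symm.isFiniteDimensional_left hX) hY
  rw [s.dimVec_eq hX, map_add, LinearMap.add_apply, ← hA, ← hB, s.finrank_Hom_left hX hY] at h
  omega

lemma extDim_right (s : Biprod X A B) (hX : X.IsFiniteDimensional) {Y : Rep k I}
    (hY : Y.IsFiniteDimensional) : extDim Y X = extDim Y A + extDim Y B := by
  have h := finrank_Hom_sub_extDim hY hX
  have hA := finrank_Hom_sub_extDim hY (s.isFiniteDimensional_left hX)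
  have hB := finrank_Hom_sub_extDim hY (s.symm.isFiniteDimensional_left hX)
  rw [s.dimVec_eq hX, map_add, ← hA, ← hB, s.finrank_Hom_right hX hY] at h
  omega

end Biprod

/-- The projection to a subrepresentation along a complementary one. -/
noncomputable def subProj (X : Rep k I) {U W : ∀ i, Submodule k (X.V i)}
    (hU : X.IsSubrep U) (hW : X.IsSubrep W) (h : ∀ i, IsCompl (U i) (W i)) :
    Hom X (X.sub U hU) :=
  ⟨fun i => (U i).projectionOnto (W i) (h i), mem_Hom_iff.mpr fun i j a x => by
    have hx : x ∈ U i ⊔ W i := (h i).sup_eq_top ▸ Submodule.mem_top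
    obtain ⟨u, hu, w, hw, rfl⟩ := Submodule.mem_sup.mp hx
    let p (l : I) : X.V l →ₗ[k] (X.sub U hU).V l := (U l).projectionOnto (W l) (h l)
    have hpU (l : I) (x : X.V l) (hx : x ∈ U l) : p l x = subMk X U hU hx :=
      Submodule.projectionOnto_apply_of_mem_left _ hx
    have hpW (l : I) (x : X.V l) (hx : x ∈ W l) : p l x = 0 :=
      Submodule.projectionOnto_apply_of_mem_right _ hx
    change p j _ = (X.sub U hU).map a (p i _)
    rw [map_add, map_add, map_add, hpU i u hu, hpW i w hw, hpU j _ (hU i j a u hu),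
      hpW j _ (hW i j a w hw), add_zero, add_zero]
    rfl⟩

/-- Complementary subrepresentations give a direct sum decomposition. -/
noncomputable def biprodOfIsCompl (X : Rep k I) {U W : ∀ i, Submodule k (X.V i)}
    (hU : X.IsSubrep U) (hW : X.IsSubrep W) (h : ∀ i, IsCompl (U i) (W i)) :
    Biprod X (X.sub U hU) (X.sub W hW) where
  inl := subIncl X U hU
  inr := subIncl X W hW
  fst := subProj X hU hW h
  snd := subProj X hW hU fun i => (h i).symm
  fst_inl i x := Submodule.projectionOnto_apply_left (h i) x
  snd_inr i x := Submodule.projectionOnto_apply_left (h i).symm x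
  snd_inl i x := Submodule.projectionOnto_apply_right (h i).symm x
  fst_inr i x := Submodule.projectionOnto_apply_right (h i) x
  inl_fst_add_inr_snd i x := by
    change ((U i).projectionOnto (W i) (h i) x : X.V i) +
      ((W i).projectionOnto (U i) (h i).symm x : X.V i) = x
    have hx : x ∈ U i ⊔ W i := (h i).sup_eq_top ▸ Submodule.mem_top
    obtain ⟨u, hu, w, hw, rfl⟩ := Submodule.mem_sup.mp hx
    rw [map_add, map_add, Submodule.projectionOnto_apply_of_mem_left _ hu,
      Submodule.projectionOnto_apply_of_mem_left _ hw,
      Submodule.projectionOnto_apply_of_mem_right _ hu,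
      Submodule.projectionOnto_apply_of_mem_right _ hw, add_zero, zero_add]

end Biprod

/-! ### Extensions -/

section Extension

variable {k : Type u} [Field k] {I : Type v} [Quiver.{w} I]

/-- The extension of `B` by `A` with cocycle `g`. -/
def extension (A B : Rep k I) (g : ∀ i j : I, (i ⟶ j) → (B.V i →ₗ[k] A.V j)) : Rep k I where
  V i := A.V i × B.V i
  map {i j} a := (A.map a ∘ₗ LinearMap.fst k _ _ + g i j a ∘ₗ LinearMap.snd k _ _).prod
    (B.map a ∘ₗ LinearMap.snd k _ _)

variable (A B : Rep k I) (g : ∀ i j : I, (i ⟶ j) → (B.V i →ₗ[k] A.V j))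

/-- The inclusion of the subrepresentation in an extension. -/
def extInl : Hom A (extension A B g) :=
  ⟨fun i => LinearMap.inl k (A.V i) (B.V i), mem_Hom_iff.mpr fun i j a x => by
    apply Prod.ext
    · change A.map a x = A.map a x + g i j a 0
      simp
    · change 0 = B.map a 0
      simp⟩

/-- The projection of an extension to the quotient. -/
def extSnd : Hom (extension A B g) B :=
  ⟨fun i => LinearMap.snd k (A.V i) (B.V i), mem_Hom_iff.mpr fun _ _ _ _ => rfl⟩

/-- The linear, not necessarily equivariant, inclusion of the quotient in an extension. -/
def extInr (i : I) : B.V i →ₗ[k] (extension A B g).V i := LinearMap.inr k (A.V i) (B.V i)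

/-- The linear, not necessarily equivariant, projection of an extension to the
subrepresentation. -/
def extFst (i : I) : (extension A B g).V i →ₗ[k] A.V i := LinearMap.fst k (A.V i) (B.V i)

variable {A B}

lemma extension_map_extInr {i j : I} (a : i ⟶ j) (y : B.V i) :
    (extension A B g).map a (extInr A B g i y) =
      (extInl A B g).1 j (g i j a y) + extInr A B g j (B.map a y) := by
  apply Prod.ext
  · change A.map a 0 + g i j a y = g i j a y + 0
    simp
  · change B.map a y = 0 + B.map a y
    simp

lemma extFst_map {i j : I} (a : i ⟶ j) (z : (extension A B g).V i) :
    extFst A B g j ((extension A B g).map a z) =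
      A.map a (extFst A B g i z) + g i j a ((extSnd A B g).1 i z) :=
  rfl

lemma extInl_add_extInr {i : I} (z : (extension A B g).V i) :
    (extInl A B g).1 i (extFst A B g i z) + extInr A B g i ((extSnd A B g).1 i z) = z := by
  apply Prod.ext
  · exact add_zero _
  · exact zero_add _

lemma isFiniteDimensional_extension (hA : A.IsFiniteDimensional) (hB : B.IsFiniteDimensional) :
    (extension A B g).IsFiniteDimensional := by
  intro i
  have := hA i
  have := hB i
  exact inferInstanceAs (FiniteDimensional k (A.V i × B.V i))

lemma dimVec_extension (hA : A.IsFiniteDimensional) (hB : B.IsFiniteDimensional) :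
    (extension A B g).dimVec = A.dimVec + B.dimVec := by
  funext i
  have := hA i
  have := hB i
  have h : Module.finrank k ((extension A B g).V i) =
      Module.finrank k (A.V i) + Module.finrank k (B.V i) := Module.finrank_prod
  simp [dimVec, h]

/-- The trivial extension is the direct sum. -/
def biprodExtension (A B : Rep k I) : Biprod (extension A B 0) A B where
  inl := extInl A B 0
  inr := ⟨extInr A B 0, mem_Hom_iff.mpr fun i j a y => by
    rw [extension_map_extInr]
    change extInr A B 0 j (B.map a y) = (extInl A B 0).1 j 0 + _
    rw [map_zero, zero_add]⟩
  fst := ⟨extFst A B 0, mem_Hom_iff.mpr fun i j a y => by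
    rw [extFst_map]
    change A.map a _ + 0 = _
    rw [add_zero]⟩
  snd := extSnd A B 0
  fst_inl _ _ := rfl
  snd_inr _ _ := rfl
  snd_inl _ _ := rfl
  fst_inr _ _ := rfl
  inl_fst_add_inr_snd _ z := extInl_add_extInr 0 z

variable [Finite I]

lemma finrank_ker_comp_extInl_le (hB : B.IsFiniteDimensional) {Y : Rep k I}
    (hY : Y.IsFiniteDimensional) :
    Module.finrank k (LinearMap.ker (Hom.comp.flip (extInl A B g) :
      Hom (extension A B g) Y →ₗ[k] Hom A Y)) ≤ Module.finrank k (Hom B Y) := by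
  have := finiteDimensional_Hom hB hY
  have hle : LinearMap.ker (Hom.comp.flip (extInl A B g) :
      Hom (extension A B g) Y →ₗ[k] Hom A Y) ≤
      LinearMap.range (Hom.comp.flip (extSnd A B g)) := by
    intro f hf
    have hf' (i : I) (x : A.V i) : f.1 i ((extInl A B g).1 i x) = 0 :=
      LinearMap.congr_fun (congrFun (congrArg Subtype.val hf) i) x
    refine ⟨⟨fun i => f.1 i ∘ₗ extInr A B g i, mem_Hom_iff.mpr fun i j a y => ?_⟩,
      Hom.ext_apply fun i z => ?_⟩
    · rw [LinearMap.comp_apply, LinearMap.comp_apply, ← Hom.naturality, extension_map_extInr,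
        map_add, hf', zero_add]
    · conv_rhs => rw [← extInl_add_extInr g z, map_add, hf', zero_add]
      rfl
  have := Module.Finite.range (Hom.comp.flip (extSnd A B g) : Hom B Y →ₗ[k] _)
  exact (Submodule.finrank_mono hle).trans (LinearMap.finrank_range_le _)

lemma finrank_Hom_extension_left_le (hA : A.IsFiniteDimensional) (hB : B.IsFiniteDimensional)
    {Y : Rep k I} (hY : Y.IsFiniteDimensional) : Module.finrank k (Hom (extension A B g) Y) ≤
      Module.finrank k (Hom A Y) + Module.finrank k (Hom B Y) := by
  have := finiteDimensional_Hom hA hY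
  have := finiteDimensional_Hom (isFiniteDimensional_extension g hA hB) hY
  rw [← (Hom.comp.flip (extInl A B g) : _ →ₗ[k] Hom A Y).finrank_range_add_finrank_ker]
  exact add_le_add (Submodule.finrank_le _) (finrank_ker_comp_extInl_le g hB hY)

/-- For a nonsplit extension, the identity of `A` is not in the image of the restriction map
`Hom(E, A) ⟶ Hom(A, A)`. -/
lemma finrank_Hom_extension_lt (hA : A.IsFiniteDimensional) (hB : B.IsFiniteDimensional)
    (hg : g ∉ LinearMap.range (coboundary B A)) : Module.finrank k (Hom (extension A B g) A) <
      Module.finrank k (Hom A A) + Module.finrank k (Hom B A) := by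
  have := finiteDimensional_Hom hA hA
  have := finiteDimensional_Hom (isFiniteDimensional_extension g hA hB) hA
  rw [← (Hom.comp.flip (extInl A B g) : _ →ₗ[k] Hom A A).finrank_range_add_finrank_ker]
  refine add_lt_add_of_lt_of_le (Submodule.finrank_lt fun htop => hg ?_)
    (finrank_ker_comp_extInl_le g hB hA)
  obtain ⟨r, hr⟩ := LinearMap.range_eq_top.mp htop (Hom.id A)
  have hr' (i : I) (x : A.V i) : r.1 i ((extInl A B g).1 i x) = x :=
    LinearMap.congr_fun (congrFun (congrArg Subtype.val hr) i) x
  refine ⟨fun i => -(r.1 i ∘ₗ extInr A B g i), ?_⟩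
  funext i j a
  ext y
  have h := Hom.naturality r a (extInr A B g i y)
  rw [extension_map_extInr, map_add, hr'] at h
  simp only [coboundary_apply, LinearMap.neg_apply, LinearMap.comp_apply, map_neg, ← h]
  abel

lemma finrank_Hom_extension_right_le (hA : A.IsFiniteDimensional) (hB : B.IsFiniteDimensional)
    {Y : Rep k I} (hY : Y.IsFiniteDimensional) : Module.finrank k (Hom Y (extension A B g)) ≤
      Module.finrank k (Hom Y A) + Module.finrank k (Hom Y B) := by
  have := finiteDimensional_Hom hY hA
  have := finiteDimensional_Hom hY hB
  have := finiteDimensional_Hom hY (isFiniteDimensional_extension g hA hB)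
  rw [← (Hom.comp (extSnd A B g) : Hom Y _ →ₗ[k] _).finrank_range_add_finrank_ker, add_comm]
  refine add_le_add ?_ (Submodule.finrank_le _)
  have hle : LinearMap.ker (Hom.comp (extSnd A B g) : Hom Y _ →ₗ[k] _) ≤
      LinearMap.range (Hom.comp (extInl A B g)) := by
    intro f hf
    have hf' (i : I) (y : Y.V i) : (extSnd A B g).1 i (f.1 i y) = 0 :=
      LinearMap.congr_fun (congrFun (congrArg Subtype.val hf) i) y
    refine ⟨⟨fun i => extFst A B g i ∘ₗ f.1 i, mem_Hom_iff.mpr fun i j a y => ?_⟩,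
      Hom.ext_apply fun i y => ?_⟩
    · rw [LinearMap.comp_apply, LinearMap.comp_apply, Hom.naturality, extFst_map, hf', map_zero,
        add_zero]
    · conv_rhs => rw [← extInl_add_extInr g (f.1 i y), hf', map_zero, add_zero]
      rfl
  exact (Submodule.finrank_mono hle).trans (LinearMap.finrank_range_le _)

/-- Replacing a direct sum by a nonsplit extension decreases the dimension of the endomorphism
algebra. -/
lemma finrank_Hom_extension_self_lt {X : Rep k I} (hX : X.IsFiniteDimensional)
    (s : Biprod X A B) (hg : g ∉ LinearMap.range (coboundary B A)) :
    Module.finrank k (Hom (extension A B g) (extension A B g)) < Module.finrank k (Hom X X) := by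
  have hA := s.isFiniteDimensional_left hX
  have hB := s.symm.isFiniteDimensional_left hX
  have hE := isFiniteDimensional_extension g hA hB
  have h1 := finrank_Hom_extension_right_le g hA hB hE
  have h2 := finrank_Hom_extension_lt g hA hB hg
  have h3 := finrank_Hom_extension_left_le g hA hB hB
  rw [s.finrank_Hom_left hX hX, s.finrank_Hom_right hX hA, s.finrank_Hom_right hX hB]
  omega

end Extension

/-! ### Existence of indecomposable representations -/

section Existence

variable {k : Type u} [Field k] {I : Type v} [Quiver.{w} I]

lemma exists_dimVec_eq {a : I → ℤ} (ha : 0 ≤ a) :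
    ∃ X : Rep k I, X.IsFiniteDimensional ∧ X.dimVec = a := by
  refine ⟨{ V := fun i => Fin (a i).toNat → k, map := fun _ => 0 }, fun i => ?_, ?_⟩
  · exact inferInstanceAs (FiniteDimensional k (Fin (a i).toNat → k))
  · funext i
    have : Module.finrank k (Fin (a i).toNat → k) = (a i).toNat := Module.finrank_fin_fun k
    simp only [dimVec, this]
    exact Int.toNat_of_nonneg (ha i)

lemma isIndecomposable_of_finrank_Hom_eq_one {X : Rep k I}
    (h : Module.finrank k (Hom X X) = 1) : X.IsIndecomposable := by
  have hid : Hom.id X ≠ 0 := by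
    intro h0
    have hz (f : Hom X X) : f = 0 := Hom.ext_apply fun i x => by
      have h1 : x = 0 := LinearMap.congr_fun (congrFun (congrArg Subtype.val h0) i) x
      rw [h1, map_zero, map_zero]
    have : Subsingleton (Hom X X) := ⟨fun f g => (hz f).trans (hz g).symm⟩
    rw [Module.finrank_zero_of_subsingleton] at h
    exact zero_ne_one h
  refine ⟨?_, fun U W hU hW hc => ?_⟩
  · by_contra! hs
    exact hid (Hom.ext_apply fun i x => by have := hs i; exact Subsingleton.elim _ _)
  · have s := X.biprodOfIsCompl hU hW hc
    obtain ⟨c, hcs⟩ := (finrank_eq_one_iff_of_nonzero' (Hom.id X) hid).mp h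
      (Hom.comp (subIncl X U hU) (subProj X hU hW hc))
    have hcs' (i : I) (x : X.V i) : c • x = ((U i).projectionOnto (W i) (hc i) x : X.V i) :=
      LinearMap.congr_fun (congrFun (congrArg Subtype.val hcs) i) x
    rcases eq_or_ne c 0 with rfl | hc0
    · refine Or.inl fun i => (Submodule.eq_bot_iff _).mpr fun x hx => ?_
      have := hcs' i x
      rw [Submodule.projectionOnto_apply_of_mem_left _ hx, zero_smul] at this
      exact this.symm
    · refine Or.inr fun i => (Submodule.eq_bot_iff _).mpr fun x hx => ?_
      have := hcs' i x
      rw [Submodule.projectionOnto_apply_of_mem_right _ hx] at this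
      exact (smul_eq_zero_iff_right hc0).mp this

variable [Fintype I] [∀ i j : I, Finite (i ⟶ j)]

/-- As indecomposable representations are rigid, a representation which is not rigid is a direct sum
`A ⊕ B` with `Ext¹(B, A) ≠ 0`. -/
lemma exists_biprod_of_extDim_ne_zero {X : Rep k I} (hX : X.IsFiniteDimensional)
    (hpd : TitsPosDef I) (hext : extDim X X ≠ 0) :
    ∃ A B : Rep k I, Nonempty (Biprod X A B) ∧ extDim B A ≠ 0 := by
  induction hn : X.totalDim using Nat.strong_induction_on generalizing X with
  | _ n ih =>
    have : ∀ i, FiniteDimensional k (X.V i) := hX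
    have hnr : ¬ ExtVanishes X X := fun h => hext ((extVanishes_iff_extDim_eq_zero hX hX).mp h)
    have hnt : ∃ i, Nontrivial (X.V i) := by
      by_contra! h
      refine hnr fun g => ⟨0, ?_⟩
      funext i j a
      ext x
      have := h j
      exact Subsingleton.elim _ _
    have hnind : ¬ X.IsIndecomposable := fun h => hnr (h.extVanishes hX hpd)
    simp only [IsIndecomposable, hnt, true_and, not_forall, not_or] at hnind
    obtain ⟨U, W, hU, hW, hc, ⟨i, hi⟩, ⟨j, hj⟩⟩ := hnind
    have s := X.biprodOfIsCompl hU hW hc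
    have hA := s.isFiniteDimensional_left hX
    have hB := s.symm.isFiniteDimensional_left hX
    have hfin (i : I) : Module.finrank k (U i) + Module.finrank k (W i) =
        Module.finrank k (X.V i) := Submodule.finrank_add_eq_of_isCompl (hc i)
    have hUlt : (X.sub U hU).totalDim < n := by
      rw [← hn]
      refine Finset.sum_lt_sum (fun i _ => (U i).finrank_le) ⟨j, Finset.mem_univ j, ?_⟩
      have h1 := Submodule.one_le_finrank_iff.mpr hj
      have h2 := hfin j
      change Module.finrank k (U j) < _
      omega
    have hWlt : (X.sub W hW).totalDim < n := by
      rw [← hn]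
      refine Finset.sum_lt_sum (fun i _ => (W i).finrank_le) ⟨i, Finset.mem_univ i, ?_⟩
      have h1 := Submodule.one_le_finrank_iff.mpr hi
      have h2 := hfin i
      change Module.finrank k (W i) < _
      omega
    -- a bad decomposition of a direct summand gives one of `X`
    have hstep {A B : Rep k I} (t : Biprod X A B) (hlt : A.totalDim < n)
        (hA : extDim A A ≠ 0) :
        ∃ A B : Rep k I, Nonempty (Biprod X A B) ∧ extDim B A ≠ 0 := by
      have hAf := t.isFiniteDimensional_left hX
      have hBf := t.symm.isFiniteDimensional_left hX
      obtain ⟨A₁, A₂, ⟨r⟩, hr⟩ := ih _ hlt hAf hA rfl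
      have hA₂ := r.symm.isFiniteDimensional_left hAf
      refine ⟨A₁, _, ⟨t.assoc r (biprodExtension A₂ B)⟩, ?_⟩
      rw [(biprodExtension A₂ B).extDim_left (isFiniteDimensional_extension 0 hA₂ hBf)
        (r.isFiniteDimensional_left hAf)]
      omega
    rw [s.extDim_left hX hX, s.extDim_right hX hA, s.extDim_right hX hB] at hext
    by_cases hAA : extDim (X.sub U hU) (X.sub U hU) = 0
    · by_cases hBB : extDim (X.sub W hW) (X.sub W hW) = 0
      · by_cases hBA : extDim (X.sub W hW) (X.sub U hU) = 0
        · exact ⟨_, _, ⟨s.symm⟩, by omega⟩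
        · exact ⟨_, _, ⟨s⟩, hBA⟩
      · exact hstep s.symm hWlt hBB
    · exact hstep s hUlt hAA

/-- Every positive root `a` is the dimension vector of an indecomposable representation, namely of
the representation with the smallest endomorphism algebra among those with dimension vector `a`. -/
lemma exists_isIndecomposable_dimVec_eq (hpd : TitsPosDef I) {a : I → ℤ} (ha : 0 ≤ a)
    (haa : eulerForm a a = 1) :
    ∃ X : Rep k I, X.IsFiniteDimensional ∧ X.IsIndecomposable ∧ X.dimVec = a := by
  classical
  have hP : ∃ n, ∃ X : Rep k I, X.IsFiniteDimensional ∧ X.dimVec = a ∧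
      Module.finrank k (Hom X X) = n := by
    obtain ⟨X, hX, hdim⟩ := exists_dimVec_eq (k := k) ha
    exact ⟨_, X, hX, hdim, rfl⟩
  obtain ⟨X, hX, hdim, hn⟩ := Nat.find_spec hP
  refine ⟨X, hX, isIndecomposable_of_finrank_Hom_eq_one ?_, hdim⟩
  have hext : extDim X X = 0 := by
    by_contra hne
    obtain ⟨A, B, ⟨s⟩, hBA⟩ := exists_biprod_of_extDim_ne_zero hX hpd hne
    have hA := s.isFiniteDimensional_left hX
    have hB := s.symm.isFiniteDimensional_left hX
    have hnv : ¬ ExtVanishes B A := fun h => hBA ((extVanishes_iff_extDim_eq_zero hB hA).mp h)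
    obtain ⟨g, hg⟩ := not_forall.mp hnv
    have hlt := finrank_Hom_extension_self_lt g hX s hg
    rw [hn] at hlt
    exact Nat.find_min hP hlt ⟨extension A B g, isFiniteDimensional_extension g hA hB,
      by rw [dimVec_extension g hA hB, ← hdim, s.dimVec_eq hX], rfl⟩
  have h := finrank_Hom_sub_extDim hX hX
  rw [hdim, haa, hext] at h
  omega

end Existence

end Rep

/-! ### Special quivers -/

section Special

variable (k : Type u) [Field k] {I : Type v} [Quiver.{w} I] [Fintype I]
  [∀ i j : I, Finite (i ⟶ j)]

/-- Being special is a property of the root system, by Gabriel's theorem: it means that the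
positive roots are at most `1` at the sources. -/
lemma isSpecial_iff (hpd : TitsPosDef I) :
    IsSpecial k I ↔
      ∀ i : I, IsSource i → ∀ a : I → ℤ, 0 ≤ a → eulerForm a a = 1 → a i ≤ 1 := by
  classical
  constructor
  · intro h i hi a ha haa
    obtain ⟨X, hX, hind, rfl⟩ := Rep.exists_isIndecomposable_dimVec_eq (k := k) hpd ha haa
    have h1 := Rep.eulerForm_le_finrank_Hom_simple hX i
    have h2 := h i X hX hind
    rw [eulerForm_single_right, Finset.sum_eq_zero fun j _ => by have := hi j; simp] at h1
    omega
  · intro h i X hX hind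
    by_contra! hlt
    have h1 := (hind.extVanishes hX hpd).finrank_Hom_simple hX i (by omega)
    have h2 := hpd.eulerForm_single_le_one h i X.dimVec_nonneg
      (hind.eulerForm_dimVec_self hX hpd)
    omega

end Special

/-! ### Root systems with the Cartan matrix of the quiver -/

section RootSystem

/-- A symmetric matrix which can be symmetrized to a positive definite matrix by a positive diagonal
matrix is itself positive definite, as the diagonal entries are constant on its blocks. -/
lemma sum_mul_pos_of_posDef_mul_diagonal {J : Type*} [Fintype J] [DecidableEq J]
    {C : Matrix J J ℤ} (hC : ∀ i j, C i j = C j i) {d : J → ℤ} (hd : ∀ i, 0 < d i)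
    (hpos : (C * Matrix.diagonal d).PosDef) {a : J → ℤ} (ha : a ≠ 0) :
    0 < ∑ i, ∑ j, C i j * (a i * a j) := by
  have hdd (i j : J) (hij : C i j ≠ 0) : d i = d j := by
    have h := hpos.isHermitian.apply i j
    simp only [Matrix.mul_diagonal, star_trivial, hC j i] at h
    exact mul_left_cancel₀ hij h
  let r (c : ℤ) (i : J) : ℤ := if d i = c then a i else 0
  have hsplit : ∑ i, ∑ j, C i j * (a i * a j) =
      ∑ c ∈ Finset.univ.image d, ∑ i, ∑ j, C i j * (r c i * r c j) := by
    symm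
    rw [Finset.sum_comm]
    refine Finset.sum_congr rfl fun i _ => ?_
    rw [Finset.sum_comm]
    refine Finset.sum_congr rfl fun j _ => ?_
    by_cases hij : C i j = 0
    · simp [hij]
    · rw [Finset.sum_eq_single (d i)]
      · simp [r, hdd i j hij]
      · intro c _ hc
        simp [r, hc.symm]
      · simp
  have hval (c : ℤ) : dotProduct (star (r c)) ((C * Matrix.diagonal d).mulVec (r c)) =
      c * ∑ i, ∑ j, C i j * (r c i * r c j) := by
    simp only [dotProduct, Matrix.mulVec, Matrix.mul_diagonal, Finset.mul_sum, star_trivial]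
    refine Finset.sum_congr rfl fun i _ => Finset.sum_congr rfl fun j _ => ?_
    by_cases hj : d j = c
    · rw [hj]; ring
    · simp [r, hj]
  have hposc (c : ℤ) (hc : 0 < c) (h : r c ≠ 0) :
      0 < ∑ i, ∑ j, C i j * (r c i * r c j) := by
    have := hpos.dotProduct_mulVec_pos h
    rw [hval] at this
    exact pos_of_mul_pos_right this hc.le
  rw [hsplit]
  obtain ⟨i, hi⟩ := Function.ne_iff.mp ha
  refine Finset.sum_pos' (fun c hc => ?_) ⟨d i, by simp, hposc _ (hd i) fun h => hi ?_⟩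
  · obtain ⟨j, -, rfl⟩ := Finset.mem_image.mp hc
    by_cases h : r (d j) = 0
    · simp [h]
    · exact (hposc _ (hd j) h).le
  · simpa [r] using congrFun h i

variable {ι R M N : Type*} [Field R] [AddCommGroup M] [Module R M] [AddCommGroup N]
  [Module R N] {P : RootPairing ι R M N} {b : P.Base}
  {I : Type v} [Fintype I] {e : I ≃ b.support}

variable (e) in
/-- The function `a` consists of the coefficients of the root with index `β` with respect to the
simple roots, and also of the coefficients of its coroot with respect to the simple coroots. (In the
simply-laced case, they agree.) -/
def HasCoeffs (β : ι) (a : I → ℤ) : Prop :=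
  P.root β = ∑ i, a i • P.root (e i) ∧ P.coroot β = ∑ i, a i • P.coroot (e i)

lemma hasCoeffs_single [DecidableEq I] (i : I) : HasCoeffs e (e i : ι) (Pi.single i 1) := by
  constructor <;> simp [Pi.single_apply]

lemma HasCoeffs.neg {β : ι} {a : I → ℤ} (h : HasCoeffs e β a) :
    HasCoeffs e (P.reflectionPerm β β) (-a) := by
  constructor
  · rw [P.root_reflectionPerm, P.reflection_apply_self, h.1]
    simp
  · rw [P.coroot_reflectionPerm, P.coreflection_apply_self, h.2]
    simp

variable [P.IsCrystallographic] [Quiver.{w} I]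

lemma titsPosDef_of_cartanMatrix_eq [CharZero R] [Finite ι] [P.IsRootSystem]
    (h : ∀ i j : I, b.cartanMatrix (e i) (e j) = cartanMatrix I i j) : TitsPosDef I := by
  classical
  intro a ha
  obtain ⟨d, hd, hpos⟩ := b.exists_cartanMatrix_mul_diagaonal_posDef
  have h1 := sum_mul_pos_of_posDef_mul_diagonal (C := b.cartanMatrix) (fun i j => by
    rw [← e.apply_symm_apply i, ← e.apply_symm_apply j, h, h, cartanMatrix_symm]) hd hpos
    (a := a ∘ e.symm) (fun h0 => ha (funext fun i => by simpa using congrFun h0 (e i)))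
  rw [← e.sum_comp] at h1
  simp_rw [← e.sum_comp (fun j => b.cartanMatrix _ j * _)] at h1
  simp only [h, Function.comp_apply, Equiv.symm_apply_apply] at h1
  rw [← eulerForm_add_eulerForm_swap] at h1
  omega

lemma HasCoeffs.reflect [DecidableEq I]
    (hC : ∀ i j : I, b.cartanMatrix (e i) (e j) = cartanMatrix I i j) {β : ι} {a : I → ℤ}
    (h : HasCoeffs e β a) (j : I) :
    HasCoeffs e (P.reflectionPerm (e j) β)
      (a - (eulerForm a (Pi.single j 1) + eulerForm (Pi.single j 1) a) • Pi.single j 1) := by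
  have hp (i l : I) : P.pairing (e i) (e l) = (cartanMatrix I i l : R) := by
    rw [← hC, ← P.algebraMap_pairingIn ℤ]
    rfl
  have hm : eulerForm a (Pi.single j 1) + eulerForm (Pi.single j 1) a =
      ∑ i, cartanMatrix I i j * a i := by
    rw [eulerForm_add_eulerForm_swap]
    simp [Pi.single_apply]
  have h1 : P.pairing β (e j) = ((∑ i, cartanMatrix I i j * a i : ℤ) : R) := by
    rw [← P.root_coroot_eq_pairing, h.1]
    simp [hp, mul_comm]
  have h2 : P.pairing (e j) β = ((∑ i, cartanMatrix I i j * a i : ℤ) : R) := by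
    rw [← P.root_coroot_eq_pairing, h.2]
    simp [hp, mul_comm, cartanMatrix_symm j]
  rw [hm]
  constructor
  · rw [P.root_reflectionPerm, P.reflection_apply_root, h1, h.1, Int.cast_smul_eq_zsmul]
    simp [sub_smul, Finset.sum_sub_distrib, Pi.single_apply]
  · rw [P.coroot_reflectionPerm, P.coreflection_apply_coroot, h2, h.2, Int.cast_smul_eq_zsmul]
    simp [sub_smul, Finset.sum_sub_distrib, Pi.single_apply]

lemma eulerForm_reflect_self [DecidableEq I] (hpd : TitsPosDef I) (a : I → ℤ) (j : I) :
    eulerForm (a - (eulerForm a (Pi.single j 1) + eulerForm (Pi.single j 1) a) • Pi.single j 1)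
      (a - (eulerForm a (Pi.single j 1) + eulerForm (Pi.single j 1) a) • Pi.single j 1) =
    eulerForm a a := by
  simp only [map_sub, map_smul, LinearMap.sub_apply, LinearMap.smul_apply,
    hpd.eulerForm_single_self, smul_eq_mul]
  ring

lemma exists_hasCoeffs [CharZero R] [Finite ι] [P.IsRootSystem] [P.IsReduced] (hpd : TitsPosDef I)
    (hC : ∀ i j : I, b.cartanMatrix (e i) (e j) = cartanMatrix I i j) (β : ι) :
    ∃ a, HasCoeffs e β a ∧ eulerForm a a = 1 := by
  classical
  refine b.induction_reflect β (p := fun β => ∃ a, HasCoeffs e β a ∧ eulerForm a a = 1) ?_ ?_ ?_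
  · rintro β ⟨a, h, ha⟩
    exact ⟨-a, h.neg, by simpa using ha⟩
  · intro β hβ
    refine ⟨Pi.single (e.symm ⟨β, hβ⟩) 1, ?_, hpd.eulerForm_single_self _⟩
    simpa using hasCoeffs_single (e := e) (e.symm ⟨β, hβ⟩)
  · rintro β γ ⟨a, h, ha⟩ hγ
    refine ⟨_, ?_, (eulerForm_reflect_self hpd a (e.symm ⟨γ, hγ⟩)).trans ha⟩
    simpa using h.reflect hC (e.symm ⟨γ, hγ⟩)

/-- In the simply-laced case, all positive solutions of `⟨a, a⟩ = 1` are roots: a solution `a` which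
is not a simple root `eᵢ` has a simple root with `(a, eᵢ) = 1`, and `sᵢ(a) = a - eᵢ` is a smaller
solution. -/
lemma exists_root_hasCoeffs (hpd : TitsPosDef I)
    (hC : ∀ i j : I, b.cartanMatrix (e i) (e j) = cartanMatrix I i j) {a : I → ℤ} (ha : 0 ≤ a)
    (haa : eulerForm a a = 1) : ∃ β, HasCoeffs e β a := by
  classical
  induction hn : (∑ i, a i).toNat using Nat.strong_induction_on generalizing a with
  | _ n ih =>
    obtain ⟨i, hi⟩ : ∃ i, 0 < a i * (eulerForm a (Pi.single i 1) + eulerForm (Pi.single i 1) a) := by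
      by_contra! hle
      have h := Finset.sum_nonpos fun i (_ : i ∈ Finset.univ) => hle i
      have h2 : ∑ i, a i * (eulerForm a (Pi.single i 1) + eulerForm (Pi.single i 1) a) =
          eulerForm a a + eulerForm a a := by
        rw [eulerForm_add_eulerForm_swap, Finset.sum_comm]
        refine Finset.sum_congr rfl fun i _ => ?_
        rw [eulerForm_add_eulerForm_swap, Finset.mul_sum]
        refine Finset.sum_congr rfl fun j _ => ?_
        simp [Pi.single_apply]
        ring
      omega
    have hai : 0 < a i := lt_of_le_of_ne (ha i) fun h => by simp [← h] at hi
    have hm := pos_of_mul_pos_right hi hai.le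
    rcases eq_or_ne (a - Pi.single i 1) 0 with h0 | h0
    · rw [sub_eq_zero] at h0
      exact ⟨_, h0 ▸ hasCoeffs_single i⟩
    · have hpos := hpd _ h0
      have hexp : eulerForm (a - Pi.single i 1) (a - Pi.single i 1) =
          2 - (eulerForm a (Pi.single i 1) + eulerForm (Pi.single i 1) a) := by
        simp only [map_sub, LinearMap.sub_apply, hpd.eulerForm_single_self, haa]
        ring
      have hm1 : eulerForm a (Pi.single i 1) + eulerForm (Pi.single i 1) a = 1 := by omega
      have hnn : 0 ≤ a - Pi.single i 1 := fun j => by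
        rcases eq_or_ne j i with rfl | hj
        · simp; omega
        · simpa [hj] using ha j
      obtain ⟨β, hβ⟩ := ih _ (by
        have h1 : ∑ j, (a - Pi.single i 1 : I → ℤ) j = ∑ j, a j - 1 := by
          simp [Finset.sum_sub_distrib]
        have h2 : a i ≤ ∑ j, a j := Finset.single_le_sum (fun j _ => ha j) (Finset.mem_univ i)
        rw [h1, ← hn]
        omega) hnn (by rw [hexp, hm1]; norm_num) rfl
      have h := hβ.reflect hC i
      have hr : eulerForm (a - Pi.single i 1) (Pi.single i 1) +
          eulerForm (Pi.single i 1) (a - Pi.single i 1) = -1 := by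
        simp only [map_sub, LinearMap.sub_apply, hpd.eulerForm_single_self]
        omega
      rw [hr] at h
      exact ⟨_, by simpa using h⟩

end RootSystem

/-! ### Minuscule weights -/

section LieAlgebra

variable {𝔤 : Type z} [LieRing 𝔤] [LieAlgebra ℂ 𝔤] [FiniteDimensional ℂ 𝔤]
  [LieAlgebra.IsKilling ℂ 𝔤] {H : LieSubalgebra ℂ 𝔤} [H.IsCartanSubalgebra]
  {I : Type v} [Fintype I] {b : (LieAlgebra.IsKilling.rootSystem H).Base} {e : I ≃ b.support}

lemma HasCoeffs.fundamentalWeight_coroot {β : H.root} {a : I → ℤ} (h : HasCoeffs e β a) (i : I) :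
    fundamentalWeight b (e i) ((LieAlgebra.IsKilling.rootSystem H).coroot β) = a i := by
  classical
  have hj (j : I) : fundamentalWeight b (e i) ((LieAlgebra.IsKilling.rootSystem H).coroot (e j)) =
      if j = i then 1 else 0 := by
    rw [fundamentalWeight, Module.Basis.coord_apply, b.toCoweightBasis_repr_coroot,
      Finsupp.single_apply]
    simp
  rw [h.2, map_sum, Finset.sum_eq_single i]
  · rw [map_zsmul, hj, if_pos rfl, zsmul_one]
  · intro j _ hji
    rw [map_zsmul, hj, if_neg hji, smul_zero]
  · simp

variable [Quiver.{w} I]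

lemma isMinuscule_fundamentalWeight_iff (hC : IsAssociated I b e) (i : I) :
    IsMinuscule b (fundamentalWeight b (e i)) ↔
      ∀ a : I → ℤ, 0 ≤ a → eulerForm a a = 1 → a i ≤ 1 := by
  have hpd : TitsPosDef I := titsPosDef_of_cartanMatrix_eq hC
  set P := LieAlgebra.IsKilling.rootSystem H
  constructor
  · intro h a ha haa
    obtain ⟨β, hβ⟩ := exists_root_hasCoeffs hpd hC ha haa
    obtain ⟨m, hm, hm1⟩ := h (P.reflectionPerm β β) (by
      rw [IsNegative, P.root_reflectionPerm, P.reflection_apply_self, neg_neg, hβ.1]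
      refine sum_mem fun j _ => ?_
      rw [← Int.toNat_of_nonneg (ha j), natCast_zsmul]
      exact nsmul_mem (AddSubmonoid.subset_closure (Set.mem_image_of_mem _ (e j).2)) _)
    rw [hβ.neg.fundamentalWeight_coroot] at hm
    simp only [Pi.neg_apply, Int.cast_neg, neg_neg] at hm
    rw [Int.cast_injective hm]
    exact hm1
  · intro h β hβ
    obtain ⟨a, hβa, haa⟩ := exists_hasCoeffs (e := e) hpd hC β
    refine ⟨-a i, by rw [hβa.fundamentalWeight_coroot, Int.cast_neg], ?_⟩
    rcases hpd.nonneg_or_nonpos haa with ha | ha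
    · have := ha i
      simp only [Pi.zero_apply] at this
      omega
    · exact h (-a) (neg_nonneg.mpr ha) (by simpa using haa)

end LieAlgebra

/-! ### Type `E₈` -/

section E₈

variable {I : Type v} [Quiver.{w} I] [Fintype I]

lemma two_mul_eulerForm_self_of_equiv {n : ℕ} {C : Matrix (Fin n) (Fin n) ℤ} {e : I ≃ Fin n}
    (hC : ∀ i j : I, cartanMatrix I i j = C (e i) (e j)) (x : Fin n → ℤ) :
    2 * eulerForm (x ∘ e) (x ∘ e) = ∑ i, ∑ j, C i j * (x i * x j) := by
  rw [two_mul, eulerForm_add_eulerForm_swap, ← e.sum_comp]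
  simp_rw [← e.sum_comp (fun j => C _ j * _), hC]
  rfl

lemma sum_E₈_mul_eq (x : Fin 8 → ℤ) :
    ∑ i, ∑ j, CartanMatrix.E₈ i j * (x i * x j) =
      2 * (x 0 ^ 2 + x 1 ^ 2 + x 2 ^ 2 + x 3 ^ 2 + x 4 ^ 2 + x 5 ^ 2 + x 6 ^ 2 + x 7 ^ 2 -
        x 0 * x 2 - x 1 * x 3 - x 2 * x 3 - x 3 * x 4 - x 4 * x 5 - x 5 * x 6 - x 6 * x 7) := by
  simp [Fin.sum_univ_eight, CartanMatrix.E₈]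
  ring

lemma titsPosDef_of_E₈ {e : I ≃ Fin 8}
    (hC : ∀ i j : I, cartanMatrix I i j = CartanMatrix.E₈ (e i) (e j)) : TitsPosDef I := by
  intro a ha
  have h := two_mul_eulerForm_self_of_equiv hC (a ∘ e.symm)
  have hcomp : (a ∘ e.symm) ∘ e = a := by ext; simp
  rw [hcomp, sum_E₈_mul_eq] at h
  set x := a ∘ e.symm with hx
  by_contra! hle
  -- completion of squares, from the ends of the diagram towards the branch vertex
  have hsq : 120 * eulerForm a a = 30 * (2 * x 1 - x 3) ^ 2 + 30 * (2 * x 0 - x 2) ^ 2 +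
      10 * (3 * x 2 - 2 * x 3) ^ 2 + 30 * (2 * x 7 - x 6) ^ 2 + 10 * (3 * x 6 - 2 * x 5) ^ 2 +
      5 * (4 * x 5 - 3 * x 4) ^ 2 + 3 * (5 * x 4 - 4 * x 3) ^ 2 + 2 * x 3 ^ 2 := by
    linear_combination 60 * h
  have p₀ := sq_nonneg (2 * x 1 - x 3)
  have p₁ := sq_nonneg (2 * x 0 - x 2)
  have p₂ := sq_nonneg (3 * x 2 - 2 * x 3)
  have p₃ := sq_nonneg (2 * x 7 - x 6)
  have p₄ := sq_nonneg (3 * x 6 - 2 * x 5)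
  have p₅ := sq_nonneg (4 * x 5 - 3 * x 4)
  have p₆ := sq_nonneg (5 * x 4 - 4 * x 3)
  have p₇ := sq_nonneg (x 3)
  have z₀ := pow_eq_zero_iff (n := 2) two_ne_zero |>.mp (le_antisymm (by linarith) p₀)
  have z₁ := pow_eq_zero_iff (n := 2) two_ne_zero |>.mp (le_antisymm (by linarith) p₁)
  have z₂ := pow_eq_zero_iff (n := 2) two_ne_zero |>.mp (le_antisymm (by linarith) p₂)
  have z₃ := pow_eq_zero_iff (n := 2) two_ne_zero |>.mp (le_antisymm (by linarith) p₃)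
  have z₄ := pow_eq_zero_iff (n := 2) two_ne_zero |>.mp (le_antisymm (by linarith) p₄)
  have z₅ := pow_eq_zero_iff (n := 2) two_ne_zero |>.mp (le_antisymm (by linarith) p₅)
  have z₆ := pow_eq_zero_iff (n := 2) two_ne_zero |>.mp (le_antisymm (by linarith) p₆)
  have z₇ := pow_eq_zero_iff (n := 2) two_ne_zero |>.mp (le_antisymm (by linarith) p₇)
  have hx0 : ∀ l : Fin 8, x l = 0 := by
    intro l
    fin_cases l <;> simp <;> omega
  exact ha (funext fun i => by simpa [hx] using hx0 (e i))

lemma not_isSpecial_of_E₈ (k : Type u) [Field k] [∀ i j : I, Finite (i ⟶ j)] {e : I ≃ Fin 8}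
    (hC : ∀ i j : I, cartanMatrix I i j = CartanMatrix.E₈ (e i) (e j)) : ¬ IsSpecial k I := by
  have hpd := titsPosDef_of_E₈ hC
  have : Nonempty I := ⟨e.symm 0⟩
  obtain ⟨i, hi⟩ := hpd.exists_isSource
  rw [isSpecial_iff k hpd]
  intro h
  -- the highest root, all of whose coefficients are at least `2`
  let x : Fin 8 → ℤ := ![2, 3, 4, 6, 5, 4, 3, 2]
  have hx : ∀ l, 2 ≤ x l := by decide
  have hxx : eulerForm (x ∘ e) (x ∘ e) = 1 := by
    have h2 := two_mul_eulerForm_self_of_equiv hC x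
    rw [sum_E₈_mul_eq] at h2
    simp [x] at h2
    omega
  have h1 := h i hi (x ∘ e) (fun l => by have := hx (e l); simp; omega) hxx
  have h2 := hx (e i)
  simp only [Function.comp_apply] at h1
  omega

end E₈

end DynkinQuiver

theorem corollary2 {k : Type u} [Field k] {I : Type v} [Quiver.{w} I]
    (hI : DynkinQuiver.IsDynkin I) :
    (∀ {𝔤 : Type z} [LieRing 𝔤] [LieAlgebra ℂ 𝔤] [FiniteDimensional ℂ 𝔤]
        [LieAlgebra.IsKilling ℂ 𝔤] (H : LieSubalgebra ℂ 𝔤) [H.IsCartanSubalgebra]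
        (b : (LieAlgebra.IsKilling.rootSystem H).Base) (e : I ≃ b.support),
        DynkinQuiver.IsAssociated I b e →
        (DynkinQuiver.IsSpecial k I ↔
          ∀ i : I, DynkinQuiver.IsSource i →
            DynkinQuiver.IsMinuscule b (DynkinQuiver.fundamentalWeight b (e i)))) ∧
      (DynkinQuiver.HasType I CartanMatrix.E₈ → ¬ DynkinQuiver.IsSpecial k I) := by
  constructor
  · intro 𝔤 _ _ _ _ H _ b e hC
    have hfin : ∀ i j : I, Finite (i ⟶ j) := by
      rcases hI with ⟨_, _, h⟩ | ⟨_, _, h⟩ | h | h | h <;> exact h.1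
    let _ : Fintype I := Fintype.ofEquiv _ e.symm
    rw [DynkinQuiver.isSpecial_iff k (DynkinQuiver.titsPosDef_of_cartanMatrix_eq hC)]
    simp_rw [DynkinQuiver.isMinuscule_fundamentalWeight_iff hC]
  · rintro ⟨hfin, e, hC⟩
    let _ : Fintype I := Fintype.ofEquiv _ e.symm
    exact DynkinQuiver.not_isSpecial_of_E₈ k hC
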